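/- **Setting.** Let $\mathcal G=(\mathcal S,\mathcal A)$ be a finite directed network with origin $s_o$ and destination $s_d$, let $\mathcal L\subseteq\mathcal S$ be the set of critical nodes, partitioned into kinds $\mathcal L_1,\dots,\mathcal L_K$, let $M_k\in\mathbb N$ be the number of resources of kind $k$, and let $L^x,U^x\in\mathbb R$ and $\mu>0$. The feasible set is $\mathcal X=\{\mathbf x\in\mathbb R^{\mathcal L}: \sum_{s\in\mathcal L_k}x_s\le M_k\ \forall k,\ L^x\le x_s\le U^x\ \forall s\}$. Critical nodes have adversary utility $v(s;\mathbf x)=w^f_sx_s+t^f_s$ with $w^f_s<0$ and defender reward $r^l(s,x_s)=w^l_sx_s+t^l_s$ with $w^l_s>0$; non-critical nodes have constant adversary utility $v(s;\mathbf x)=t^f_s$. Let $\Omega$ be the set of paths (without repeated nodes) from $s_o$ to $s_d$, $U(\tau;\mathbf x)=\sum_{s\in\tau}v(s;\mathbf x)$, and $$\mathcal F^l(\mathbf x)=\sum_{s\in\mathcal L}r^l(s,x_s)\sum_{\tau\in\Omega,\,\tau\ni s}P(\tau),\qquad P(\tau)=\frac{e^{U(\tau;\mathbf x)/\mu}}{\sum_{\tau'\in\Omega}e^{U(\tau';\mathbf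 x)/\mu}} .$$ For $s\in\mathcal L$ let $\Delta(s)$ (respectively $\Delta^+(s)$) be the set of paths in $\Omega$ that cross $s$ and no other critical node (respectively $s$ and at least one other critical node); assume that every $\Delta(s)$ is non-empty. Put $$\beta_1=\max_{\mathbf x\in\mathcal X}\max_{s\in\mathcal L}\frac{\sum_{\tau\in\Delta^+(s)}e^{U(\tau;\mathbf x)/\mu}}{\sum_{\tau\in\Delta(s)}e^{U(\tau;\mathbf x)/\mu}},\qquad \beta_2=\max_{\mathbf x\in\mathcal X}\frac{\sum_{\tau\in\bigcup_s\Delta^+(s)}e^{U(\tau;\mathbf x)/\mu}}{\sum_{\tau\in\bigcup_s\Delta(s)}e^{U(\tau;\mathbf x)/\mu}},\qquad \kappa=\max_{\mathbf x\in\mathcal X}\sum_{s\in\mathcal L}|r^l(s,x_s)|,$$ $$\widetilde{\mathcal F}(\mathbf x)=\frac{\sum_{s\in\mathcal L}\sum_{\tau\in\Delta(s)}r^l(s,x_s)e^{U(\tau;\mathbf x)/\mu}}{\sum_{s\in\mathcal L}\sum_{\tau\in\Delta(s)}e^{U(\tau;\mathbf x)/\mu}} .$$ **Modified network.** Let $\mathcal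 G'$ arise from $\mathcal G$ by raising the costs of travelling between critical nodes: the utility of a path becomes $U'(\tau;\mathbf x)=U(\tau;\mathbf x)-c(\tau)$ with $c(\tau)\ge 0$, and $c(\tau)=0$ if $\tau$ crosses at most one critical node. Let $\epsilon'>0$ be such that for all $\mathbf x\in\mathcal X$ and $s\in\mathcal L$ $$\frac{\sum_{\tau\in\Delta^+(s)}e^{U'(\tau;\mathbf x)/\mu}}{\sum_{\tau\in\Omega,\,\tau\ni s}e^{U'(\tau;\mathbf x)/\mu}}\le\epsilon',\qquad \frac{\sum_{\tau\in\bigcup_s\Delta^+(s)}e^{U'(\tau;\mathbf x)/\mu}}{\sum_{\tau\in\Omega}e^{U'(\tau;\mathbf x)/\mu}}\le\epsilon' .$$ **Binary search on $\mathcal G'$.** Let $$g(\mathbf x,\delta|\mathcal G')=\sum_{s\in\mathcal L}\sum_{\tau\in\Omega,\,\tau\ni s}r^l(s,x_s)e^{U'(\tau;\mathbf x)/\mu}-\delta\sum_{\tau\in\Omega}e^{U'(\tau;\mathbf x)/\mu}.$$ The search starts from an interval that contains all values on $\mathcal X$ of the objective $\mathcal F^l$ of the network $\mathcal G'$. At the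 midpoint $\delta$ of the current interval it computes a local maximum $\mathbf x_\delta$ of $g(\cdot,\delta|\mathcal G')$ over $\mathcal X$, and it keeps the upper half of the interval if $g(\mathbf x_\delta,\delta|\mathcal G')\ge0$ and the lower half otherwise. Its output $(\overline{\mathbf x},\overline\delta)$ is understood in the limit of unlimited precision: either $\overline{\mathbf x}$ is a local maximum of $g(\cdot,\overline\delta|\mathcal G')$ over $\mathcal X$ with $g(\overline{\mathbf x},\overline\delta|\mathcal G')=0$, or the lower ends of the intervals converge to $\overline\delta$ and $\overline{\mathbf x}$ is a limit point of the local maxima computed for the lower ends. **Theorem.** For every such output $(\overline{\mathbf x},\overline\delta)$, $$\mathcal F^l(\overline{\mathbf x})\ \ge\ \frac1{\overline\eta}\max_{\mathbf x\in\mathcal X}\mathcal F^l(\mathbf x)-\kappa\,\frac{\overline\eta-1}{\overline\eta},\qquad \overline\eta=(1+\beta_1)(1+\beta_2)(1+\epsilon'\,\mathcal U),$$ where $\mathcal F^l$ is the objective of the original network $\mathcal G$ and $\mathcal U$ is the following constant, which involves neither $\epsilon'$, $\beta_1$, $\beta_2$ nor the modification $\mathcal G'$: with $\mathbf e$ the all-one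 vector, $\rho^s=\sum_{\tau\in\Omega,\,\tau\ni s}e^{U(\tau;L^x\mathbf e)/\mu}$ and $\rho=\sum_{\tau\in\Omega}e^{U(\tau;L^x\mathbf e)/\mu}$, $$\mathcal U=\frac{\mathcal H+2\mathcal C}{\bigl(\min_{\mathbf x\in\mathcal X}\widetilde{\mathcal F}(\mathbf x)+\kappa\bigr)\sum_{s\in\mathcal L}\sum_{\tau\in\Delta(s)}e^{U(\tau;U^x\mathbf e)/\mu}},\qquad \mathcal C=\kappa\max_{s}\rho^s+\kappa\rho,$$ $$\mathcal H=2\sum_{s\in\mathcal L}\Bigl(\mu\frac{w^l_s}{|w^f_s|}\rho^s+\kappa\max_{s'}\rho^{s'}+\kappa\rho\Bigr)\exp\Bigl(\frac{w^f_s(L^x-U^x)}{\mu}\Bigr),$$ and $\mathcal U$ is read as $0$ in the degenerate case that its denominator is $0$. -/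

import Mathlib

noncomputable section

open scoped Classical

/-- A network interdiction game between a defender and a boundedly rational (logit) adversary, on
the finite node set `S`, with linear utilities. A strategy of the defender is a vector of coverage
probabilities indexed by the critical nodes. -/
structure InterdictionGame (S : Type*) where
  /-- the directed graph on which the adversary travels -/
  graph : Digraph S
  /-- the origin of the adversary -/
  origin : S
  /-- the destination of the adversary -/
  dest : S
  /-- the set of critical nodes -/
  crit : Finset S
  /-- the number of kinds of critical nodes and resources -/
  numKinds : ℕ
  /-- the kind of a critical node; the classes partition the set of critical nodes -/
  kind : crit → Fin numKinds
  /-- the number of resources of each kind -/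
  resources : Fin numKinds → ℕ
  /-- lower bound on every coverage probability -/
  lower : ℝ
  /-- upper bound on every coverage probability -/
  upper : ℝ
  /-- the rationality parameter of the adversary -/
  mu : ℝ
  mu_pos : 0 < mu
  /-- slope of the utility of the adversary at a critical node -/
  wf : crit → ℝ
  wf_neg : ∀ s, wf s < 0
  /-- constant term of the utility of the adversary at a node -/
  tf : S → ℝ
  /-- slope of the reward of the defender at a critical node -/
  wl : crit → ℝ
  wl_pos : ∀ s, 0 < wl s
  /-- constant term of the reward of the defender at a critical node -/
  tl : crit → ℝ

namespace InterdictionGame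

/-- Sequences of pairwise distinct nodes. -/
abbrev NodeSeq (S : Type*) := {l : List S // l.Nodup}

variable {S : Type*} [Fintype S] (N : InterdictionGame S)

/-- A strategy of the defender. -/
abbrev Strategy {S : Type*} (N : InterdictionGame S) := N.crit → ℝ

/-- The feasible set of strategies. -/
def feasible : Set N.Strategy :=
  {x | (∀ k, ∑ s with N.kind s = k, x s ≤ (N.resources k : ℝ)) ∧
    ∀ s, x s ∈ Set.Icc N.lower N.upper}

/-- The paths from the origin to the destination: node sequences without repetition in which
consecutive nodes are joined by an arc. -/
def paths : Finset (NodeSeq S) :=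
  {τ | τ.1.IsChain N.graph.Adj ∧ τ.1.head? = some N.origin ∧ τ.1.getLast? = some N.dest}

/-- The paths that cross the critical node `s`. -/
def pathsThrough (s : N.crit) : Finset (NodeSeq S) :=
  {τ ∈ N.paths | s.1 ∈ τ.1}

/-- The paths that cross the critical node `s` and no other critical node. -/
def soloPaths (s : N.crit) : Finset (NodeSeq S) :=
  {τ ∈ N.pathsThrough s | ∀ s' : N.crit, s'.1 ∈ τ.1 → s' = s}

/-- The paths that cross the critical node `s` and at least one other critical node. -/
def multiPaths (s : N.crit) : Finset (NodeSeq S) :=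
  {τ ∈ N.pathsThrough s | ∃ s' : N.crit, s' ≠ s ∧ s'.1 ∈ τ.1}

/-- The utility of the adversary for visiting a node. -/
def nodeUtility (x : N.Strategy) (s : S) : ℝ :=
  if h : s ∈ N.crit then N.wf ⟨s, h⟩ * x ⟨s, h⟩ + N.tf s else N.tf s

/-- The reward of the defender when the adversary crosses the critical node `s`. -/
def reward (x : N.Strategy) (s : N.crit) : ℝ := N.wl s * x s + N.tl s

/-- The utility of the adversary for a path of the original network. -/
def pathUtility (x : N.Strategy) (τ : NodeSeq S) : ℝ :=
  ∑ s ∈ τ.1.toFinset, N.nodeUtility x s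

/-- The exponential weight of a path when an additional cost `c τ` has to be paid for travelling
along `τ`. The original network is the case `c = 0`. -/
def weight (c : NodeSeq S → ℝ) (x : N.Strategy) (τ : NodeSeq S) : ℝ :=
  Real.exp ((N.pathUtility x τ - c τ) / N.mu)

/-- The probability that the adversary follows the path `τ` (logit choice over all paths). -/
def pathProb (c : NodeSeq S → ℝ) (x : N.Strategy) (τ : NodeSeq S) : ℝ :=
  N.weight c x τ / ∑ τ' ∈ N.paths, N.weight c x τ'

/-- The probability that the adversary crosses the critical node `s`. -/
def crossProb (c : NodeSeq S → ℝ) (x : N.Strategy) (s : N.crit) : ℝ :=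
  ∑ τ ∈ N.pathsThrough s, N.pathProb c x τ

/-- The expected reward of the defender. -/
def objective (c : NodeSeq S → ℝ) (x : N.Strategy) : ℝ :=
  ∑ s, N.reward x s * N.crossProb c x s

/-- The objective of the subproblem that is solved in a step of the binary search. -/
def searchObjective (c : NodeSeq S → ℝ) (x : N.Strategy) (δ : ℝ) : ℝ :=
  ∑ s, ∑ τ ∈ N.pathsThrough s, N.reward x s * N.weight c x τ
    - δ * ∑ τ ∈ N.paths, N.weight c x τ

/-- The objective of the restricted problem, in which the adversary uses only paths that cross
exactly one critical node. -/
def restrictedObjective (x : N.Strategy) : ℝ :=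
  (∑ s, ∑ τ ∈ N.soloPaths s, N.reward x s * N.weight 0 x τ) /
    ∑ s, ∑ τ ∈ N.soloPaths s, N.weight 0 x τ

/-- `β₁`, for the original network. -/
def beta₁ : ℝ :=
  sSup {b | ∃ x ∈ N.feasible, ∃ s,
    b = (∑ τ ∈ N.multiPaths s, N.weight 0 x τ) / ∑ τ ∈ N.soloPaths s, N.weight 0 x τ}

/-- `β₂`, for the original network. -/
def beta₂ : ℝ :=
  sSup {b | ∃ x ∈ N.feasible,
    b = (∑ τ ∈ Finset.univ.biUnion N.multiPaths, N.weight 0 x τ) /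
      ∑ τ ∈ Finset.univ.biUnion N.soloPaths, N.weight 0 x τ}

/-- The maximal total absolute reward `κ`. -/
def kappa : ℝ := sSup ((fun x => ∑ s, |N.reward x s|) '' N.feasible)

/-- The network modified by the additional path costs `c`: the costs of travelling between critical
nodes are raised, so that a path which crosses at most one critical node keeps its utility. -/
structure IsCostIncrease (c : NodeSeq S → ℝ) : Prop where
  nonneg : ∀ τ ∈ N.paths, 0 ≤ c τ
  eq_zero : ∀ τ ∈ N.paths, (∀ s s' : N.crit, s.1 ∈ τ.1 → s'.1 ∈ τ.1 → s = s') → c τ = 0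

/-- In the modified network, the paths that cross several critical nodes carry at most the
proportion `ε` of the weight of the paths through any given critical node, and of all paths. -/
structure IsSeparated (c : NodeSeq S → ℝ) (ε : ℝ) : Prop where
  through : ∀ x ∈ N.feasible, ∀ s,
    (∑ τ ∈ N.multiPaths s, N.weight c x τ) / ∑ τ ∈ N.pathsThrough s, N.weight c x τ ≤ ε
  all : ∀ x ∈ N.feasible,
    (∑ τ ∈ Finset.univ.biUnion N.multiPaths, N.weight c x τ) /
      ∑ τ ∈ N.paths, N.weight c x τ ≤ ε

/-- `x` is a feasible point and a local maximum over the feasible set of the subproblem of the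
binary search with parameter `δ`. -/
def IsLocalSolution (c : NodeSeq S → ℝ) (δ : ℝ) (x : N.Strategy) : Prop :=
  x ∈ N.feasible ∧ IsLocalMaxOn (fun z => N.searchObjective c z δ) N.feasible x

/-- The interval `(lo, hi)` after `n` steps of the binary search that starts from `(a, b)` and uses
`sol δ` as solution of the subproblem with parameter `δ`. -/
def bisection (c : NodeSeq S → ℝ) (sol : ℝ → N.Strategy) (a b : ℝ) : ℕ → ℝ × ℝ
  | 0 => (a, b)
  | n + 1 =>
    let I := bisection c sol a b n
    let δ := (I.1 + I.2) / 2
    if 0 ≤ N.searchObjective c (sol δ) δ then (δ, I.2) else (I.1, δ)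

/-- `(x, δ)` is obtained by the binary search for maximizing `N.objective c`, where the subproblems
are solved to local optimality. Either the search has stopped at a parameter `δ` for which the
computed local maximum has value exactly zero, or it is run with unlimited precision from
an interval that contains all values of the objective, and then the lower ends of the intervals
converge to `δ` and `x` is a limit point of the solutions computed for them. -/
def IsBinarySearchOutput (c : NodeSeq S → ℝ) (x : N.Strategy) (δ : ℝ) : Prop :=
  (N.IsLocalSolution c δ x ∧ N.searchObjective c x δ = 0) ∨
  ∃ (sol : ℝ → N.Strategy) (a b : ℝ),
    (∀ d, N.IsLocalSolution c d (sol d)) ∧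
    (∀ z ∈ N.feasible, N.objective c z ∈ Set.Icc a b) ∧
    Filter.Tendsto (fun n => (N.bisection c sol a b n).1) Filter.atTop (nhds δ) ∧
    MapClusterPt x Filter.atTop (fun n => sol (N.bisection c sol a b n).1)

/-- `ρˢ`: the weight of the paths through `s` when every coverage is at its lower bound. -/
def rhoThrough (s : N.crit) : ℝ := ∑ τ ∈ N.pathsThrough s, N.weight 0 (fun _ => N.lower) τ

/-- `ρ`: the weight of all paths when every coverage is at its lower bound. -/
def rho : ℝ := ∑ τ ∈ N.paths, N.weight 0 (fun _ => N.lower) τ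

/-- `λ`: the weight of the paths that cross exactly one critical node when every coverage is at its
upper bound. -/
def lam : ℝ := ∑ s, ∑ τ ∈ N.soloPaths s, N.weight 0 (fun _ => N.upper) τ

/-- The constant `C`. -/
def constC : ℝ := N.kappa * (⨆ s, N.rhoThrough s) + N.kappa * N.rho

/-- The constant `H`. -/
def constH : ℝ :=
  2 * ∑ s, (N.mu * (N.wl s / |N.wf s|) * N.rhoThrough s + N.kappa * (⨆ s', N.rhoThrough s')
    + N.kappa * N.rho) * Real.exp (N.wf s * (N.lower - N.upper) / N.mu)

/-- The constant `U`. -/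
def constU : ℝ :=
  (N.constH + 2 * N.constC) /
    ((sInf (N.restrictedObjective '' N.feasible) + N.kappa) * N.lam)

/-- The factor `η̄`. -/
def etaBar (ε : ℝ) : ℝ := (1 + N.beta₁) * (1 + N.beta₂) * (1 + ε * N.constU)

end InterdictionGame

end

noncomputable section

open scoped Classical

set_option linter.unusedSectionVars false

namespace InterdictionGame

/-! ### Path weights as functions of the strategy. -/

section

variable {S : Type*} [Fintype S] (N : InterdictionGame S)

/-! Split the paths into those crossing no, exactly one, or several critical nodes. The extra costs
leave the first two classes untouched, so the truncated ratio `truncObjective` built from these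
classes is common to both networks and serves as the bridge between them. Every reward exceeds `-κ`,
so after adding `κ` to the objectives all comparisons can be made multiplicatively.

In the original network, passing to the truncated ratio and back costs the factors `1 + β₁` and `1 +
β₂` (`objective_add_kappa_le`, `truncObjective_add_kappa_le`). It remains to show that the search
output is optimal for the truncated ratio up to the factor `1 + ε * constU`.

For this, use the variables `y_s = exp (wf s * x s / μ)`. A path with a single critical node has
weight proportional to one `y_s`, so `truncSearch` is a separable sum of terms in `-y_s log y_s` and
`y_s`, hence concave. Segments in `y` pull back to curves inside the feasible set. At a local
maximum of `truncSearch + manySearch` the total slope towards any feasible `z` is at most zero,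
while concavity makes the slope of `truncSearch` at least its gap to `z`. The gap is therefore
bounded by the slope of `manySearch`, which separation makes `O(ε)`
(`IsLocalSolution.truncSearch_sub_le`).

In the limit of the bisection, the lower ends yield a nonnegative subproblem value at the output,
and the upper ends yield the near-optimality estimate (`IsBinarySearchOutput.spec`). Dividing by
weights gives an additive error for the truncated ratio, which `sInf_add_kappa_mul_lam_le` turns
into the factor `1 + ε * constU`. -/

lemma pathUtility_eq (x : N.Strategy) (τ : NodeSeq S) :
    N.pathUtility x τ =
      (∑ s : N.crit, if s.1 ∈ τ.1 then N.wf s * x s else 0) + ∑ v ∈ τ.1.toFinset, N.tf v := by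
  set f : S → ℝ := fun v => if h : v ∈ N.crit then N.wf ⟨v, h⟩ * x ⟨v, h⟩ else 0 with hf
  have h1 : ∀ v, N.nodeUtility x v = f v + N.tf v := by
    intro v
    by_cases h : v ∈ N.crit <;> simp [nodeUtility, hf, h]
  have h2 : (∑ s : N.crit, if s.1 ∈ τ.1 then N.wf s * x s else 0) =
      ∑ v ∈ N.crit, if v ∈ τ.1 then f v else 0 := by
    rw [← Finset.sum_coe_sort N.crit fun v => if v ∈ τ.1 then f v else 0]
    refine Finset.sum_congr rfl fun s _ => ?_
    simp [hf]
  rw [h2, pathUtility, Finset.sum_congr rfl fun v _ => h1 v, Finset.sum_add_distrib,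
    ← Finset.sum_filter]
  congr 1
  symm
  refine Finset.sum_subset (fun v hv => by simpa using (Finset.mem_filter.1 hv).2) ?_
  intro v hv hv'
  have : v ∉ N.crit := fun h => hv' (Finset.mem_filter.2 ⟨h, by simpa using hv⟩)
  simp [hf, this]

lemma weight_eq (c : NodeSeq S → ℝ) (x : N.Strategy) (τ : NodeSeq S) :
    N.weight c x τ =
      Real.exp ((∑ s : N.crit, if s.1 ∈ τ.1 then N.wf s * x s else 0) / N.mu)
        * N.weight c 0 τ := by
  rw [weight, weight, ← Real.exp_add, pathUtility_eq, pathUtility_eq]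
  congr 1
  simp
  ring

lemma weight_pos (c : NodeSeq S → ℝ) (x : N.Strategy) (τ : NodeSeq S) : 0 < N.weight c x τ :=
  Real.exp_pos _

lemma weight_anti (c : NodeSeq S → ℝ) {x y : N.Strategy} (h : ∀ s, x s ≤ y s) (τ : NodeSeq S) :
    N.weight c y τ ≤ N.weight c x τ := by
  rw [weight_eq, weight_eq N c x]
  refine mul_le_mul_of_nonneg_right (Real.exp_le_exp.2 ?_) (N.weight_pos _ _ _).le
  refine div_le_div_of_nonneg_right (Finset.sum_le_sum fun s _ => ?_) N.mu_pos.le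
  split_ifs
  · exact mul_le_mul_of_nonpos_left (h s) (N.wf_neg s).le
  · exact le_rfl

lemma weight_le_of_nonneg {c : NodeSeq S → ℝ} (x : N.Strategy) {τ : NodeSeq S} (h : 0 ≤ c τ) :
    N.weight c x τ ≤ N.weight 0 x τ := by
  refine Real.exp_le_exp.2 (div_le_div_of_nonneg_right ?_ N.mu_pos.le)
  simpa using h

lemma weight_congr {c c' : NodeSeq S → ℝ} (x : N.Strategy) {τ : NodeSeq S} (h : c τ = c' τ) :
    N.weight c x τ = N.weight c' x τ := by
  rw [weight, weight, h]

lemma continuous_weight (c : NodeSeq S → ℝ) (τ : NodeSeq S) :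
    Continuous fun x => N.weight c x τ := by
  rw [funext fun x => N.weight_eq c x τ]
  simp_rw [← Finset.sum_filter]
  fun_prop

/-! ### Decomposition by the number of critical nodes crossed. -/

lemma mem_pathsThrough {s : N.crit} {τ : NodeSeq S} :
    τ ∈ N.pathsThrough s ↔ τ ∈ N.paths ∧ s.1 ∈ τ.1 := by
  simp [pathsThrough]

lemma mem_soloPaths {s : N.crit} {τ : NodeSeq S} :
    τ ∈ N.soloPaths s ↔
      (τ ∈ N.paths ∧ s.1 ∈ τ.1) ∧ ∀ s' : N.crit, s'.1 ∈ τ.1 → s' = s := by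
  rw [soloPaths, Finset.mem_filter, mem_pathsThrough]

lemma mem_multiPaths {s : N.crit} {τ : NodeSeq S} :
    τ ∈ N.multiPaths s ↔
      (τ ∈ N.paths ∧ s.1 ∈ τ.1) ∧ ∃ s' : N.crit, s' ≠ s ∧ s'.1 ∈ τ.1 := by
  rw [multiPaths, Finset.mem_filter, mem_pathsThrough]

/-- The paths that cross no critical node. -/
def freePaths : Finset (NodeSeq S) := {τ ∈ N.paths | ∀ s : N.crit, s.1 ∉ τ.1}

/-- The paths that cross at least two critical nodes. -/
def manyPaths : Finset (NodeSeq S) := Finset.univ.biUnion N.multiPaths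

/-- The weight of the paths that cross no critical node; it depends on no strategy. -/
def freeWeight : ℝ := ∑ τ ∈ N.freePaths, N.weight 0 0 τ

/-- The weight of the paths that cross `s` as their only critical node. -/
def soloWeight (x : N.Strategy) (s : N.crit) : ℝ := ∑ τ ∈ N.soloPaths s, N.weight 0 x τ

/-- The weight of the paths that cross `s` and some other critical node. -/
def multiWeight (c : NodeSeq S → ℝ) (x : N.Strategy) (s : N.crit) : ℝ :=
  ∑ τ ∈ N.multiPaths s, N.weight c x τ

/-- The weight of the paths that cross at least two critical nodes. -/
def manyWeight (c : NodeSeq S → ℝ) (x : N.Strategy) : ℝ := ∑ τ ∈ N.manyPaths, N.weight c x τ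

/-- The total weight of the paths that cross at most one critical node. -/
def truncWeight (x : N.Strategy) : ℝ := N.freeWeight + ∑ s, N.soloWeight x s

/-- The total reward, weighted over the paths that cross exactly one critical node. -/
def truncReward (x : N.Strategy) : ℝ := ∑ s, N.reward x s * N.soloWeight x s

/-- The part of the subproblem of the binary search that stems from the paths that cross at most
one critical node. -/
def truncSearch (x : N.Strategy) (δ : ℝ) : ℝ := N.truncReward x - δ * N.truncWeight x

/-- The part of the subproblem of the binary search that stems from the paths that cross at least
two critical nodes. -/
def manySearch (c : NodeSeq S → ℝ) (x : N.Strategy) (δ : ℝ) : ℝ :=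
  ∑ s, N.reward x s * N.multiWeight c x s - δ * N.manyWeight c x

/-- On such a path only the coordinate `x s` enters the utility. This makes the truncated subproblem
separable. -/
lemma soloWeight_eq (x : N.Strategy) (s : N.crit) :
    N.soloWeight x s = Real.exp (N.wf s * x s / N.mu) * N.soloWeight 0 s := by
  rw [soloWeight, soloWeight, Finset.mul_sum]
  refine Finset.sum_congr rfl fun τ hτ => ?_
  obtain ⟨⟨-, h1⟩, h2⟩ := N.mem_soloPaths.1 hτ
  rw [weight_eq, Finset.sum_eq_single s, if_pos h1]
  · intro s' _ hs'
    exact if_neg fun h => hs' (h2 s' h)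
  · simp

lemma IsCostIncrease.zero : N.IsCostIncrease 0 := ⟨fun _ _ => le_rfl, fun _ _ _ => rfl⟩

lemma soloWeight_nonneg (x : N.Strategy) (s : N.crit) : 0 ≤ N.soloWeight x s :=
  Finset.sum_nonneg fun _ _ => (N.weight_pos _ _ _).le

lemma soloWeight_pos (hsolo : ∀ s : N.crit, (N.soloPaths s).Nonempty) (x : N.Strategy)
    (s : N.crit) : 0 < N.soloWeight x s :=
  Finset.sum_pos (fun _ _ => N.weight_pos _ _ _) (hsolo s)

lemma multiWeight_nonneg (c : NodeSeq S → ℝ) (x : N.Strategy) (s : N.crit) :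
    0 ≤ N.multiWeight c x s :=
  Finset.sum_nonneg fun _ _ => (N.weight_pos _ _ _).le

lemma manyWeight_nonneg (c : NodeSeq S → ℝ) (x : N.Strategy) : 0 ≤ N.manyWeight c x :=
  Finset.sum_nonneg fun _ _ => (N.weight_pos _ _ _).le

lemma freeWeight_nonneg : 0 ≤ N.freeWeight :=
  Finset.sum_nonneg fun _ _ => (N.weight_pos _ _ _).le

variable {N} {c : NodeSeq S → ℝ}

lemma IsCostIncrease.sum_soloPaths (hc : N.IsCostIncrease c) (x : N.Strategy) (s : N.crit) :
    ∑ τ ∈ N.soloPaths s, N.weight c x τ = N.soloWeight x s := by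
  refine Finset.sum_congr rfl fun τ hτ => N.weight_congr x ?_
  obtain ⟨⟨h0, -⟩, h2⟩ := N.mem_soloPaths.1 hτ
  exact hc.eq_zero τ h0 fun s1 s2 h h' => (h2 s1 h).trans (h2 s2 h').symm

lemma IsCostIncrease.sum_freePaths (hc : N.IsCostIncrease c) (x : N.Strategy) :
    ∑ τ ∈ N.freePaths, N.weight c x τ = N.freeWeight := by
  refine Finset.sum_congr rfl fun τ hτ => ?_
  obtain ⟨h0, h⟩ := Finset.mem_filter.1 hτ
  rw [N.weight_congr x (c' := 0) (hc.eq_zero τ h0 fun s1 s2 h1 _ => absurd h1 (h s1)), weight_eq,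
    Finset.sum_eq_zero fun s _ => if_neg (h s)]
  simp

lemma IsCostIncrease.sum_pathsThrough (hc : N.IsCostIncrease c) (x : N.Strategy) (s : N.crit) :
    ∑ τ ∈ N.pathsThrough s, N.weight c x τ = N.soloWeight x s + N.multiWeight c x s := by
  rw [← hc.sum_soloPaths, multiWeight, soloPaths, multiPaths,
    ← Finset.sum_filter_add_sum_filter_not (N.pathsThrough s)
      fun τ => ∀ s' : N.crit, s'.1 ∈ τ.1 → s' = s]
  congr 2
  ext τ
  simp only [Finset.mem_filter, and_congr_right_iff]
  intro _
  push Not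
  exact exists_congr fun _ => and_comm

lemma sum_biUnion_soloPaths (f : NodeSeq S → ℝ) :
    ∑ τ ∈ Finset.univ.biUnion N.soloPaths, f τ = ∑ s, ∑ τ ∈ N.soloPaths s, f τ := by
  refine Finset.sum_biUnion fun s _ s' _ hss => Finset.disjoint_left.2 fun τ h h' => hss ?_
  exact (N.mem_soloPaths.1 h').2 s (N.mem_soloPaths.1 h).1.2

lemma IsCostIncrease.sum_paths (hc : N.IsCostIncrease c) (x : N.Strategy) :
    ∑ τ ∈ N.paths, N.weight c x τ = N.truncWeight x + N.manyWeight c x := by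
  have h1 : N.paths = (N.freePaths ∪ Finset.univ.biUnion N.soloPaths) ∪ N.manyPaths := by
    ext τ
    simp only [manyPaths, freePaths, Finset.mem_union, Finset.mem_filter, Finset.mem_biUnion,
      Finset.mem_univ, true_and, mem_soloPaths, mem_multiPaths]
    constructor
    · intro h
      by_cases h0 : ∀ s : N.crit, s.1 ∉ τ.1
      · exact Or.inl (Or.inl ⟨h, h0⟩)
      push Not at h0
      obtain ⟨s, hs⟩ := h0
      by_cases h2 : ∀ s' : N.crit, s'.1 ∈ τ.1 → s' = s
      · exact Or.inl (Or.inr ⟨s, ⟨h, hs⟩, h2⟩)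
      push Not at h2
      obtain ⟨s', h2, h3⟩ := h2
      exact Or.inr ⟨s, ⟨h, hs⟩, s', h3, h2⟩
    · rintro ((h | ⟨_, h, _⟩) | ⟨_, h, _⟩) <;> exact h.1
  have h2 : Disjoint N.freePaths (Finset.univ.biUnion N.soloPaths) := by
    refine Finset.disjoint_left.2 fun τ h h' => ?_
    obtain ⟨s, -, hs⟩ := Finset.mem_biUnion.1 h'
    exact (Finset.mem_filter.1 h).2 s (N.mem_soloPaths.1 hs).1.2
  have h3 : Disjoint (N.freePaths ∪ Finset.univ.biUnion N.soloPaths) N.manyPaths := by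
    refine Finset.disjoint_left.2 fun τ h h' => ?_
    obtain ⟨s, -, hs⟩ := Finset.mem_biUnion.1 h'
    obtain ⟨⟨-, hs⟩, s', hss, hs'⟩ := N.mem_multiPaths.1 hs
    rcases Finset.mem_union.1 h with h | h
    · exact (Finset.mem_filter.1 h).2 s hs
    · obtain ⟨t, -, ht⟩ := Finset.mem_biUnion.1 h
      have := (N.mem_soloPaths.1 ht).2
      exact hss ((this s' hs').trans (this s hs).symm)
  rw [h1, Finset.sum_union h3, Finset.sum_union h2, sum_biUnion_soloPaths, hc.sum_freePaths,
    Finset.sum_congr rfl fun s _ => hc.sum_soloPaths x s]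
  rfl

lemma IsCostIncrease.searchObjective_eq (hc : N.IsCostIncrease c) (x : N.Strategy) (δ : ℝ) :
    N.searchObjective c x δ = N.truncSearch x δ + N.manySearch c x δ := by
  rw [searchObjective, hc.sum_paths]
  simp_rw [← Finset.mul_sum, hc.sum_pathsThrough x, mul_add, Finset.sum_add_distrib]
  rw [truncSearch, manySearch, truncReward]
  ring

lemma IsCostIncrease.objective_eq (hc : N.IsCostIncrease c) (x : N.Strategy) :
    N.objective c x = (N.truncReward x + ∑ s, N.reward x s * N.multiWeight c x s) /
      (N.truncWeight x + N.manyWeight c x) := by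
  rw [objective, truncReward, ← hc.sum_paths, ← Finset.sum_add_distrib, Finset.sum_div]
  refine Finset.sum_congr rfl fun s _ => ?_
  simp_rw [crossProb, pathProb]
  rw [← Finset.sum_div, hc.sum_pathsThrough, mul_div_assoc', mul_add]

/-! ### Compactness, continuity and elementary bounds. -/

variable (N)

lemma isCompact_feasible : IsCompact N.feasible := by
  have : N.feasible = Set.Icc (fun _ => N.lower) (fun _ => N.upper) ∩
      ⋂ k, {x | ∑ s with N.kind s = k, x s ≤ (N.resources k : ℝ)} := by
    ext x
    simp only [feasible, Set.mem_ofPred_eq, Set.mem_inter_iff, Set.mem_Icc, Set.mem_iInter,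
      Pi.le_def]
    constructor
    · rintro ⟨h1, h2⟩
      exact ⟨⟨fun s => (h2 s).1, fun s => (h2 s).2⟩, h1⟩
    · rintro ⟨h1, h2⟩
      exact ⟨h2, fun s => ⟨h1.1 s, h1.2 s⟩⟩
  rw [this]
  refine isCompact_Icc.inter_right (isClosed_iInter fun k => isClosed_le ?_ continuous_const)
  fun_prop

lemma continuous_reward (s : N.crit) : Continuous fun x => N.reward x s := by
  unfold reward
  fun_prop

lemma continuous_soloWeight (s : N.crit) : Continuous fun x => N.soloWeight x s :=
  continuous_finsetSum _ fun _ _ => N.continuous_weight _ _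

lemma continuous_multiWeight (c : NodeSeq S → ℝ) (s : N.crit) :
    Continuous fun x => N.multiWeight c x s :=
  continuous_finsetSum _ fun _ _ => N.continuous_weight _ _

lemma continuous_manyWeight (c : NodeSeq S → ℝ) : Continuous fun x => N.manyWeight c x :=
  continuous_finsetSum _ fun _ _ => N.continuous_weight _ _

lemma continuous_searchObjective (c : NodeSeq S → ℝ) :
    Continuous fun p : N.Strategy × ℝ => N.searchObjective c p.1 p.2 := by
  unfold searchObjective
  have h1 := fun s => (N.continuous_reward s).comp
    (continuous_fst : Continuous (Prod.fst : N.Strategy × ℝ → _))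
  have h2 := fun τ => (N.continuous_weight c τ).comp
    (continuous_fst : Continuous (Prod.fst : N.Strategy × ℝ → _))
  refine Continuous.sub ?_ (continuous_snd.mul (continuous_finsetSum _ fun τ _ => h2 τ))
  exact continuous_finsetSum _ fun s _ => continuous_finsetSum _ fun τ _ => (h1 s).mul (h2 τ)

variable {N}

lemma sum_abs_reward_le_kappa {x : N.Strategy} (hx : x ∈ N.feasible) :
    ∑ s, |N.reward x s| ≤ N.kappa := by
  refine le_csSup (N.isCompact_feasible.bddAbove_image ?_) ⟨x, hx, rfl⟩
  exact (continuous_finsetSum _ fun s _ => (N.continuous_reward s).abs).continuousOn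

lemma abs_reward_le_kappa {x : N.Strategy} (hx : x ∈ N.feasible) (s : N.crit) :
    |N.reward x s| ≤ N.kappa :=
  (Finset.single_le_sum (f := fun s => |N.reward x s|) (fun _ _ => abs_nonneg _)
    (Finset.mem_univ s)).trans (sum_abs_reward_le_kappa hx)

variable (N)

lemma kappa_nonneg : 0 ≤ N.kappa :=
  Real.sSup_nonneg <| by
    rintro _ ⟨x, -, rfl⟩
    exact Finset.sum_nonneg fun _ _ => abs_nonneg _

lemma rhoThrough_nonneg (s : N.crit) : 0 ≤ N.rhoThrough s :=
  Finset.sum_nonneg fun _ _ => (N.weight_pos _ _ _).le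

lemma rhoThrough_le_iSup (s : N.crit) : N.rhoThrough s ≤ ⨆ s', N.rhoThrough s' :=
  le_ciSup (Set.finite_range _).bddAbove s

lemma iSup_rhoThrough_nonneg : 0 ≤ ⨆ s, N.rhoThrough s := Real.iSup_nonneg N.rhoThrough_nonneg

lemma rho_nonneg : 0 ≤ N.rho := Finset.sum_nonneg fun _ _ => (N.weight_pos _ _ _).le

/-! ### Separation makes the contribution of paths with several critical nodes of order `ε`. -/

variable {N}

lemma IsSeparated.multiWeight_le {ε : ℝ} (hε : 0 ≤ ε) (hc : N.IsCostIncrease c)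
    (hsep : N.IsSeparated c ε) {x : N.Strategy} (hx : x ∈ N.feasible) (s : N.crit) :
    N.multiWeight c x s ≤ ε * N.rhoThrough s := by
  have h1 : ∑ τ ∈ N.pathsThrough s, N.weight c x τ ≤ N.rhoThrough s :=
    Finset.sum_le_sum fun τ hτ =>
      (N.weight_le_of_nonneg x (hc.nonneg τ (N.mem_pathsThrough.1 hτ).1)).trans
        (N.weight_anti 0 (fun s => (hx.2 s).1) τ)
  have h2 := hsep.through x hx s
  -- If the denominator vanishes, the quotient is `0` by convention and the hypothesis is void; then
  -- the numerator vanishes as well.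
  rcases (Finset.sum_nonneg fun τ (_ : τ ∈ N.pathsThrough s) =>
    (N.weight_pos c x τ).le).eq_or_lt with h0 | h0
  · have : N.multiWeight c x s ≤ ∑ τ ∈ N.pathsThrough s, N.weight c x τ := by
      rw [hc.sum_pathsThrough]
      linarith [N.soloWeight_nonneg x s]
    have := mul_nonneg hε (N.rhoThrough_nonneg s)
    linarith
  · rw [div_le_iff₀ h0] at h2
    exact h2.trans (mul_le_mul_of_nonneg_left h1 hε)

lemma IsSeparated.manyWeight_le {ε : ℝ} (hε : 0 ≤ ε) (hc : N.IsCostIncrease c)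
    (hsep : N.IsSeparated c ε) {x : N.Strategy} (hx : x ∈ N.feasible) :
    N.manyWeight c x ≤ ε * N.rho := by
  have h1 : ∑ τ ∈ N.paths, N.weight c x τ ≤ N.rho :=
    Finset.sum_le_sum fun τ hτ => (N.weight_le_of_nonneg x (hc.nonneg τ hτ)).trans
        (N.weight_anti 0 (fun s => (hx.2 s).1) τ)
  have h2 := hsep.all x hx
  rcases (Finset.sum_nonneg fun τ (_ : τ ∈ N.paths) =>
    (N.weight_pos c x τ).le).eq_or_lt with h0 | h0
  · have : N.manyWeight c x ≤ ∑ τ ∈ N.paths, N.weight c x τ := by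
      rw [hc.sum_paths, truncWeight]
      linarith [N.freeWeight_nonneg, Finset.sum_nonneg fun s (_ : s ∈ Finset.univ) =>
        N.soloWeight_nonneg x s]
    have := mul_nonneg hε N.rho_nonneg
    linarith
  · rw [div_le_iff₀ h0] at h2
    exact h2.trans (mul_le_mul_of_nonneg_left h1 hε)

/-- Bounding each `ρˢ` by the maximum leaves the sum of the absolute rewards, so `κ` enters once and
not once per critical node. -/
lemma IsSeparated.sum_abs_reward_mul_multiWeight_le {ε : ℝ} (hε : 0 ≤ ε) (hc : N.IsCostIncrease c)
    (hsep : N.IsSeparated c ε) {x : N.Strategy} (hx : x ∈ N.feasible) :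
    ∑ s, |N.reward x s| * N.multiWeight c x s ≤ ε * (N.kappa * ⨆ s, N.rhoThrough s) := by
  have h : ∑ s, |N.reward x s| * N.multiWeight c x s ≤
      ∑ s, |N.reward x s| * (ε * ⨆ s, N.rhoThrough s) :=
    Finset.sum_le_sum fun s _ => mul_le_mul_of_nonneg_left
      ((hsep.multiWeight_le hε hc hx s).trans
        (mul_le_mul_of_nonneg_left (N.rhoThrough_le_iSup s) hε)) (abs_nonneg _)
  rw [← Finset.sum_mul] at h
  have := mul_le_mul_of_nonneg_right (sum_abs_reward_le_kappa hx)
    (mul_nonneg hε N.iSup_rhoThrough_nonneg)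
  linarith

lemma IsSeparated.abs_manySearch_le {ε : ℝ} (hε : 0 ≤ ε) (hc : N.IsCostIncrease c)
    (hsep : N.IsSeparated c ε) {x : N.Strategy} (hx : x ∈ N.feasible) (δ : ℝ) :
    |N.manySearch c x δ| ≤ ε * (N.kappa * (⨆ s, N.rhoThrough s) + |δ| * N.rho) := by
  have h1 : |∑ s, N.reward x s * N.multiWeight c x s| ≤
      ∑ s, |N.reward x s| * N.multiWeight c x s := by
    refine (Finset.abs_sum_le_sum_abs _ _).trans (Finset.sum_le_sum fun s _ => ?_)
    rw [abs_mul, abs_of_nonneg (N.multiWeight_nonneg c x s)]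
  have h2 := hsep.sum_abs_reward_mul_multiWeight_le hε hc hx
  have h3 : |δ * N.manyWeight c x| ≤ |δ| * (ε * N.rho) := by
    rw [abs_mul, abs_of_nonneg (N.manyWeight_nonneg c x)]
    exact mul_le_mul_of_nonneg_left (hsep.manyWeight_le hε hc hx) (abs_nonneg _)
  have h4 := abs_sub (∑ s, N.reward x s * N.multiWeight c x s) (δ * N.manyWeight c x)
  rw [manySearch]
  linarith

end

/-! ### Concavity in exponential coordinates and near-optimality of local solutions. -/

section

variable {S : Type*} [Fintype S] (N : InterdictionGame S) {c : NodeSeq S → ℝ}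

/-- The exponential of the utility of a critical node, up to its constant term. -/
def expUtility (x : N.Strategy) (s : N.crit) : ℝ := Real.exp (N.wf s * x s / N.mu)

lemma expUtility_pos (x : N.Strategy) (s : N.crit) : 0 < N.expUtility x s := Real.exp_pos _

/-- The curve from `x` to `z` that is a straight line in terms of `expUtility`. -/
def curve (x z : N.Strategy) (t : ℝ) : N.Strategy := fun s =>
  N.mu / N.wf s * Real.log ((1 - t) * N.expUtility x s + t * N.expUtility z s)

lemma lineMap_pos {t a b : ℝ} (ht : t ∈ Set.Icc (0 : ℝ) 1) (ha : 0 < a) (hb : 0 < b) :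
    0 < (1 - t) * a + t * b := by
  rcases ht.1.eq_or_lt with rfl | h
  · simpa
  · have := mul_nonneg (sub_nonneg.2 ht.2) ha.le
    have := mul_pos h hb
    linarith

lemma expUtility_curve (x z : N.Strategy) {t : ℝ} (ht : t ∈ Set.Icc (0 : ℝ) 1) (s : N.crit) :
    N.expUtility (N.curve x z t) s = (1 - t) * N.expUtility x s + t * N.expUtility z s := by
  have h := lineMap_pos ht (N.expUtility_pos x s) (N.expUtility_pos z s)
  rw [expUtility, curve]
  have h1 := (N.wf_neg s).ne
  have h2 := N.mu_pos.ne'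
  rw [← mul_assoc, mul_div_cancel₀ _ h1, mul_div_cancel_left₀ _ h2, Real.exp_log h]

lemma eq_mul_log_expUtility (x : N.Strategy) (s : N.crit) :
    x s = N.mu / N.wf s * Real.log (N.expUtility x s) := by
  rw [expUtility, Real.log_exp]
  have h1 := (N.wf_neg s).ne
  have h2 := N.mu_pos.ne'
  field_simp

lemma curve_zero (x z : N.Strategy) : N.curve x z 0 = x := by
  funext s
  rw [curve, N.eq_mul_log_expUtility x s]
  simp

/-- The logarithm is concave and the factor `μ / wf s` is negative, so the curve runs below the
chord. -/
lemma curve_le (x z : N.Strategy) {t : ℝ} (ht : t ∈ Set.Icc (0 : ℝ) 1) (s : N.crit) :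
    N.curve x z t s ≤ (1 - t) * x s + t * z s := by
  have h := strictConcaveOn_log_Ioi.concaveOn.2 (N.expUtility_pos x s) (N.expUtility_pos z s)
    (sub_nonneg.2 ht.2) ht.1 (by ring)
  simp only [smul_eq_mul] at h
  have h0 : N.mu / N.wf s ≤ 0 := (div_neg_of_pos_of_neg N.mu_pos (N.wf_neg s)).le
  have := mul_le_mul_of_nonpos_left h h0
  rw [curve]
  refine this.trans_eq ?_
  rw [N.eq_mul_log_expUtility x s, N.eq_mul_log_expUtility z s]
  ring

lemma expUtility_anti_iff {x y : N.Strategy} {s : N.crit} :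
    N.expUtility y s ≤ N.expUtility x s ↔ x s ≤ y s := by
  rw [expUtility, expUtility, Real.exp_le_exp, div_le_div_iff_of_pos_right N.mu_pos,
    mul_le_mul_left_of_neg (N.wf_neg s)]

/-- The resource constraints and the upper bounds survive because the curve lies below the chord.
The lower bounds do not follow that way; they hold because they are upper bounds on `expUtility`,
which is affine along the curve. -/
lemma curve_mem_feasible {x z : N.Strategy} (hx : x ∈ N.feasible) (hz : z ∈ N.feasible) {t : ℝ}
    (ht : t ∈ Set.Icc (0 : ℝ) 1) : N.curve x z t ∈ N.feasible := by
  have h0 := sub_nonneg.2 ht.2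
  refine ⟨fun k => ?_, fun s => ⟨?_, ?_⟩⟩
  · have h1 := Finset.sum_le_sum fun s (_ : s ∈ Finset.univ.filter fun s => N.kind s = k) =>
      N.curve_le x z ht s
    rw [Finset.sum_add_distrib, ← Finset.mul_sum, ← Finset.mul_sum] at h1
    have h2 := mul_le_mul_of_nonneg_left (hx.1 k) h0
    have h3 := mul_le_mul_of_nonneg_left (hz.1 k) ht.1
    linarith
  · have h1 : N.expUtility x s ≤ N.expUtility (fun _ => N.lower) s :=
      N.expUtility_anti_iff.2 (hx.2 s).1
    have h2 : N.expUtility z s ≤ N.expUtility (fun _ => N.lower) s :=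
      N.expUtility_anti_iff.2 (hz.2 s).1
    refine (N.expUtility_anti_iff (x := fun _ => N.lower)).1 ?_
    rw [N.expUtility_curve x z ht]
    have h3 := mul_le_mul_of_nonneg_left h1 h0
    have h4 := mul_le_mul_of_nonneg_left h2 ht.1
    linarith
  · have h2 := mul_le_mul_of_nonneg_left (hx.2 s).2 h0
    have h3 := mul_le_mul_of_nonneg_left (hz.2 s).2 ht.1
    linarith [N.curve_le x z ht s]

/-- The restricted subproblem is concave along the curve. -/
lemma mul_sub_le_truncSearch_curve (x z : N.Strategy) (δ : ℝ) {t : ℝ}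
    (ht : t ∈ Set.Icc (0 : ℝ) 1) :
    t * (N.truncSearch z δ - N.truncSearch x δ) ≤
      N.truncSearch (N.curve x z t) δ - N.truncSearch x δ := by
  -- With `y = expUtility`, substituting `x = (μ / wf) log y` turns `wl * x * y` into a positive
  -- multiple of `-y log y`; everything else is affine in `y`.
  have key : ∀ y : N.Strategy, N.truncSearch y δ = ∑ s, N.soloWeight 0 s *
      (N.wl s * (N.mu / -N.wf s) * Real.negMulLog (N.expUtility y s) +
        (N.tl s - δ) * N.expUtility y s) - δ * N.freeWeight := by
    intro y
    rw [truncSearch, truncReward, truncWeight, mul_add, ← sub_sub, sub_right_comm,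
      Finset.mul_sum, ← Finset.sum_sub_distrib]
    congr 1
    refine Finset.sum_congr rfl fun s _ => ?_
    rw [soloWeight_eq, reward, ← expUtility, N.eq_mul_log_expUtility y s, Real.negMulLog, div_neg]
    ring
  suffices h : ∀ s, (1 - t) * (N.soloWeight 0 s *
      (N.wl s * (N.mu / -N.wf s) * Real.negMulLog (N.expUtility x s) +
        (N.tl s - δ) * N.expUtility x s)) + t * (N.soloWeight 0 s *
      (N.wl s * (N.mu / -N.wf s) * Real.negMulLog (N.expUtility z s) +
        (N.tl s - δ) * N.expUtility z s)) ≤ N.soloWeight 0 s *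
      (N.wl s * (N.mu / -N.wf s) * Real.negMulLog (N.expUtility (N.curve x z t) s) +
        (N.tl s - δ) * N.expUtility (N.curve x z t) s) by
    have := Finset.sum_le_sum fun s (_ : s ∈ Finset.univ) => h s
    rw [Finset.sum_add_distrib, ← Finset.mul_sum, ← Finset.mul_sum] at this
    rw [key, key, key]
    linarith
  intro s
  have h1 := Real.concaveOn_negMulLog.2 (N.expUtility_pos x s).le (N.expUtility_pos z s).le
    (sub_nonneg.2 ht.2) ht.1 (by ring)
  simp only [smul_eq_mul] at h1
  rw [N.expUtility_curve x z ht]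
  have h2 : 0 ≤ N.soloWeight 0 s * (N.wl s * (N.mu / -N.wf s)) :=
    mul_nonneg (N.soloWeight_nonneg _ _) (mul_nonneg (N.wl_pos s).le
      (div_nonneg N.mu_pos.le (neg_nonneg.2 (N.wf_neg s).le)))
  have h3 := mul_le_mul_of_nonneg_left h1 h2
  linarith

/-- The relative velocity of the curve in terms of `expUtility`. -/
def relVel (x z : N.Strategy) (s : N.crit) : ℝ :=
  (N.expUtility z s - N.expUtility x s) / N.expUtility x s

/-- The bound on the relative velocity. -/
def velBound (s : N.crit) : ℝ := Real.exp (N.wf s * (N.lower - N.upper) / N.mu)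

/-- The relative velocity is a ratio of two values of `expUtility` minus one. The ratio lies between
`0` and `velBound s`, which is at least `1`. -/
lemma abs_relVel_le {x z : N.Strategy} (hx : x ∈ N.feasible) (hz : z ∈ N.feasible) (s : N.crit) :
    |N.relVel x z s| ≤ N.velBound s := by
  have hw := N.wf_neg s
  have h1 : N.expUtility z s ≤ N.velBound s * N.expUtility x s := by
    rw [expUtility, expUtility, velBound, ← Real.exp_add, ← add_div]
    refine Real.exp_le_exp.2 (div_le_div_of_nonneg_right ?_ N.mu_pos.le)
    nlinarith [(hx.2 s).2, (hz.2 s).1]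
  have h2 : 1 ≤ N.velBound s := by
    refine Real.one_le_exp (div_nonneg ?_ N.mu_pos.le)
    nlinarith [(hx.2 s).1.trans (hx.2 s).2]
  have h3 := N.expUtility_pos x s
  have h4 := N.expUtility_pos z s
  rw [relVel, abs_div, abs_of_pos h3, div_le_iff₀ h3, abs_le]
  constructor <;> nlinarith

lemma hasDerivAt_curve (x z : N.Strategy) (s : N.crit) :
    HasDerivAt (fun t => N.curve x z t s) (N.mu / N.wf s * N.relVel x z s) 0 := by
  have h1 : HasDerivAt (fun t : ℝ => (1 - t) * N.expUtility x s + t * N.expUtility z s)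
      (N.expUtility z s - N.expUtility x s) 0 := by
    have := (((hasDerivAt_id (0 : ℝ)).const_sub 1).mul_const (N.expUtility x s)).add
      ((hasDerivAt_id (0 : ℝ)).mul_const (N.expUtility z s))
    refine this.congr_deriv ?_
    ring
  have h2 := (h1.log (by simpa using (N.expUtility_pos x s).ne')).const_mul (N.mu / N.wf s)
  refine h2.congr_deriv ?_
  simp [relVel]

/-- The logarithmic derivative of a weight at `t = 0` is the sum of the relative velocities at the
critical nodes on the path. -/
lemma hasDerivAt_weight_curve (c : NodeSeq S → ℝ) (x z : N.Strategy) (τ : NodeSeq S) :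
    HasDerivAt (fun t => N.weight c (N.curve x z t) τ)
      (N.weight c x τ * ∑ s : N.crit, if s.1 ∈ τ.1 then N.relVel x z s else 0) 0 := by
  have h1 : HasDerivAt
      (fun t => (∑ s : N.crit, if s.1 ∈ τ.1 then N.wf s * N.curve x z t s else 0) / N.mu)
      (∑ s : N.crit, if s.1 ∈ τ.1 then N.relVel x z s else 0) 0 := by
    have h := (HasDerivAt.fun_sum (u := Finset.univ) (x := (0 : ℝ))
      (A := fun (s : N.crit) t => if s.1 ∈ τ.1 then N.wf s * N.curve x z t s else 0)
      (A' := fun s => if s.1 ∈ τ.1 then N.mu * N.relVel x z s else 0) fun s _ => by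
        by_cases hs : s.1 ∈ τ.1
        · simp only [if_pos hs]
          refine ((N.hasDerivAt_curve x z s).const_mul (N.wf s)).congr_deriv ?_
          rw [← mul_assoc, mul_div_cancel₀ _ (N.wf_neg s).ne]
        · simp only [if_neg hs]
          exact hasDerivAt_const _ _).div_const N.mu
    refine h.congr_deriv ?_
    rw [Finset.sum_div]
    refine Finset.sum_congr rfl fun s _ => ?_
    split_ifs
    · exact mul_div_cancel_left₀ _ N.mu_pos.ne'
    · exact zero_div _
  have h2 := h1.exp.mul_const (N.weight c 0 τ)
  rw [funext fun t => N.weight_eq c (N.curve x z t) τ]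
  refine h2.congr_deriv ?_
  rw [N.weight_eq c x τ, curve_zero]
  ring

lemma hasDerivAt_sum_weight_curve (c : NodeSeq S → ℝ) (x z : N.Strategy)
    (A : Finset (NodeSeq S)) :
    HasDerivAt (fun t => ∑ τ ∈ A, N.weight c (N.curve x z t) τ)
      (∑ τ ∈ A, N.weight c x τ * ∑ s : N.crit, if s.1 ∈ τ.1 then N.relVel x z s else 0) 0 :=
  HasDerivAt.fun_sum fun τ _ => N.hasDerivAt_weight_curve c x z τ

variable {N} in
lemma abs_deriv_sum_weight_le (c : NodeSeq S → ℝ) {x z : N.Strategy} (hx : x ∈ N.feasible)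
    (hz : z ∈ N.feasible) (A : Finset (NodeSeq S)) :
    |∑ τ ∈ A, N.weight c x τ * ∑ s : N.crit, if s.1 ∈ τ.1 then N.relVel x z s else 0| ≤
      (∑ τ ∈ A, N.weight c x τ) * ∑ s, N.velBound s := by
  rw [Finset.sum_mul]
  refine (Finset.abs_sum_le_sum_abs _ _).trans (Finset.sum_le_sum fun τ _ => ?_)
  rw [abs_mul, abs_of_pos (N.weight_pos c x τ)]
  refine mul_le_mul_of_nonneg_left ?_ (N.weight_pos c x τ).le
  refine (Finset.abs_sum_le_sum_abs _ _).trans (Finset.sum_le_sum fun s _ => ?_)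
  split_ifs
  · exact N.abs_relVel_le hx hz s
  · simpa [velBound] using (Real.exp_pos _).le

/-- The coefficient of `ε` in the bound on the suboptimality of a local solution for the
restricted subproblem. -/
def gapCoeff (K : ℝ) : ℝ :=
  ∑ s, (N.mu * (N.wl s / |N.wf s|) * N.rhoThrough s + N.kappa * (⨆ s', N.rhoThrough s')
    + K * N.rho) * N.velBound s

variable {N} in
-- The product rule gives three contributions: varying rewards, varying weights through each node,
-- and the varying total weight multiplied by `δ`. They match the three terms of `gapCoeff` and are
-- bounded in `b1`, `b2` and `b3`.
lemma exists_hasDerivAt_manySearch_curve {ε : ℝ} (hε : 0 ≤ ε) (hc : N.IsCostIncrease c)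
    (hsep : N.IsSeparated c ε) {x z : N.Strategy} (hx : x ∈ N.feasible) (hz : z ∈ N.feasible)
    (δ : ℝ) :
    ∃ m', HasDerivAt (fun t => N.manySearch c (N.curve x z t) δ) m' 0 ∧
      |m'| ≤ ε * N.gapCoeff |δ| := by
  set E := ∑ s, N.velBound s with hE
  have hE0 : 0 ≤ E := Finset.sum_nonneg fun _ _ => (Real.exp_pos _).le
  set q : NodeSeq S → ℝ := fun τ => ∑ s : N.crit, if s.1 ∈ τ.1 then N.relVel x z s else 0
  have hr : ∀ s, HasDerivAt (fun t => N.reward (N.curve x z t) s)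
      (N.wl s * (N.mu / N.wf s * N.relVel x z s)) 0 := fun s =>
    ((N.hasDerivAt_curve x z s).const_mul (N.wl s)).add_const (N.tl s)
  have h1 := (HasDerivAt.fun_sum (u := Finset.univ) fun s _ =>
    (hr s).mul (N.hasDerivAt_sum_weight_curve c x z (N.multiPaths s))).sub
    ((N.hasDerivAt_sum_weight_curve c x z N.manyPaths).const_mul δ)
  refine ⟨_, h1, ?_⟩
  rw [curve_zero]
  have hm := fun s => N.multiWeight_nonneg c x s
  have b1 : ∀ s, |N.wl s * (N.mu / N.wf s * N.relVel x z s) * N.multiWeight c x s| ≤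
      ε * (N.mu * (N.wl s / |N.wf s|) * N.rhoThrough s * N.velBound s) := by
    intro s
    have h := hsep.multiWeight_le hε hc hx s
    have h' := N.abs_relVel_le hx hz s
    rw [abs_mul, abs_mul, abs_mul, abs_div, abs_of_nonneg (hm s), abs_of_pos N.mu_pos,
      abs_of_pos (N.wl_pos s)]
    calc N.wl s * (N.mu / |N.wf s| * |N.relVel x z s|) * N.multiWeight c x s
        = N.mu * (N.wl s / |N.wf s|) * (|N.relVel x z s| * N.multiWeight c x s) := by ring
      _ ≤ N.mu * (N.wl s / |N.wf s|) * (N.velBound s * (ε * N.rhoThrough s)) := by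
          refine mul_le_mul_of_nonneg_left (mul_le_mul h' h (hm s) (Real.exp_pos _).le) ?_
          exact mul_nonneg N.mu_pos.le (div_nonneg (N.wl_pos s).le (abs_nonneg _))
      _ = _ := by ring
  have b2 : ∑ s, |N.reward x s * ∑ τ ∈ N.multiPaths s, N.weight c x τ * q τ| ≤
      ε * (N.kappa * ⨆ s, N.rhoThrough s) * E := by
    have : ∑ s, |N.reward x s * ∑ τ ∈ N.multiPaths s, N.weight c x τ * q τ| ≤
        ∑ s, |N.reward x s| * N.multiWeight c x s * E := by
      refine Finset.sum_le_sum fun s _ => ?_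
      rw [abs_mul, mul_assoc]
      exact mul_le_mul_of_nonneg_left (abs_deriv_sum_weight_le c hx hz _) (abs_nonneg _)
    rw [← Finset.sum_mul] at this
    exact this.trans
      (mul_le_mul_of_nonneg_right (hsep.sum_abs_reward_mul_multiWeight_le hε hc hx) hE0)
  have b3 : |δ * ∑ τ ∈ N.manyPaths, N.weight c x τ * q τ| ≤ |δ| * (ε * N.rho * E) := by
    rw [abs_mul]
    refine mul_le_mul_of_nonneg_left ?_ (abs_nonneg _)
    exact (abs_deriv_sum_weight_le c hx hz _).trans
      (mul_le_mul_of_nonneg_right (hsep.manyWeight_le hε hc hx) hE0)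
  have hg : ε * N.gapCoeff |δ| =
      (∑ s, ε * (N.mu * (N.wl s / |N.wf s|) * N.rhoThrough s * N.velBound s)) +
      ε * (N.kappa * ⨆ s, N.rhoThrough s) * E + |δ| * (ε * N.rho * E) := by
    rw [gapCoeff]
    simp_rw [add_mul, Finset.sum_add_distrib, ← Finset.mul_sum, ← hE]
    ring
  rw [hg, Finset.sum_add_distrib]
  refine (abs_sub _ _).trans (add_le_add ((abs_add_le _ _).trans (add_le_add ?_ ?_)) b3)
  · exact (Finset.abs_sum_le_sum_abs _ _).trans (Finset.sum_le_sum fun s _ => b1 s)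
  · exact (Finset.abs_sum_le_sum_abs _ _).trans b2

open Filter Topology in
variable {N} in
/-- A local solution of the subproblem is almost optimal for the restricted subproblem. -/
lemma IsLocalSolution.truncSearch_sub_le {ε : ℝ} (hε : 0 ≤ ε) (hc : N.IsCostIncrease c)
    (hsep : N.IsSeparated c ε) {x z : N.Strategy} {δ : ℝ} (hx : N.IsLocalSolution c δ x)
    (hz : z ∈ N.feasible) :
    N.truncSearch z δ - N.truncSearch x δ ≤ ε * N.gapCoeff |δ| := by
  obtain ⟨m', hm', hb⟩ := exists_hasDerivAt_manySearch_curve hε hc hsep hx.1 hz δ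
  have hcont : ContinuousAt (N.curve x z) 0 :=
    continuousAt_pi.2 fun s => (N.hasDerivAt_curve x z s).continuousAt
  have hI : ∀ᶠ t : ℝ in 𝓝[>] 0, t ∈ Set.Ioo (0 : ℝ) 1 := Ioo_mem_nhdsGT one_pos
  -- Maximality is only relative to the feasible set, so the curve must approach `x` within it.
  have htend : Tendsto (N.curve x z) (𝓝[>] 0) (𝓝[N.feasible] x) := by
    refine tendsto_nhdsWithin_iff.2 ⟨?_, ?_⟩
    · have : Tendsto (N.curve x z) (𝓝[>] 0) (𝓝 (N.curve x z 0)) :=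
        hcont.tendsto.mono_left nhdsWithin_le_nhds
      rwa [curve_zero] at this
    · filter_upwards [hI] with t ht
      exact N.curve_mem_feasible hx.1 hz ⟨ht.1.le, ht.2.le⟩
  have hmax := htend.eventually hx.2
  have hslope := hm'.tendsto_slope_zero_right
  -- For small `t > 0`, local maximality bounds the increment of `truncSearch` by minus that of
  -- `manySearch`, while concavity bounds it below by `t` times the gap. Divide by `t` and let `t`
  -- tend to `0`.
  have : N.truncSearch z δ - N.truncSearch x δ ≤ -m' := by
    refine ge_of_tendsto hslope.neg ?_
    filter_upwards [hI, hmax] with t ht hle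
    have h := N.mul_sub_le_truncSearch_curve x z δ ⟨ht.1.le, ht.2.le⟩
    rw [hc.searchObjective_eq, hc.searchObjective_eq] at hle
    rw [zero_add, curve_zero, smul_eq_mul, ← mul_neg, ← div_eq_inv_mul, le_div_iff₀ ht.1]
    linarith
  linarith [neg_le_abs m']

end

/-! ### Comparison of the original and the truncated objective through `β₁` and `β₂`. -/

section

variable {S : Type*} [Fintype S] {N : InterdictionGame S} {c : NodeSeq S → ℝ}

lemma bddAbove_beta₁_set (hsolo : ∀ s : N.crit, (N.soloPaths s).Nonempty) :
    BddAbove {b | ∃ x ∈ N.feasible, ∃ s,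
      b = (∑ τ ∈ N.multiPaths s, N.weight 0 x τ) / ∑ τ ∈ N.soloPaths s, N.weight 0 x τ} := by
  have : {b | ∃ x ∈ N.feasible, ∃ s,
      b = (∑ τ ∈ N.multiPaths s, N.weight 0 x τ) / ∑ τ ∈ N.soloPaths s, N.weight 0 x τ} =
      ⋃ s, (fun x => N.multiWeight 0 x s / N.soloWeight x s) '' N.feasible := by
    ext b
    simp only [Set.mem_ofPred_eq, Set.mem_iUnion, Set.mem_image]
    constructor
    · rintro ⟨x, hx, s, rfl⟩
      exact ⟨s, x, hx, rfl⟩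
    · rintro ⟨s, x, hx, rfl⟩
      exact ⟨x, hx, s, rfl⟩
  rw [this, ← Set.biUnion_univ]
  refine Set.finite_univ.bddAbove_biUnion.2 fun s _ => ?_
  refine N.isCompact_feasible.bddAbove_image (Continuous.continuousOn ?_)
  exact (N.continuous_multiWeight 0 s).div (N.continuous_soloWeight s)
    fun x => (N.soloWeight_pos hsolo x s).ne'

lemma beta₁_nonneg : 0 ≤ N.beta₁ := Real.sSup_nonneg <| by
  rintro _ ⟨x, -, s, rfl⟩
  exact div_nonneg (N.multiWeight_nonneg 0 x s) (N.soloWeight_nonneg x s)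

lemma multiWeight_le_beta₁_mul (hsolo : ∀ s : N.crit, (N.soloPaths s).Nonempty) {x : N.Strategy}
    (hx : x ∈ N.feasible) (s : N.crit) :
    N.multiWeight 0 x s ≤ N.beta₁ * N.soloWeight x s := by
  rw [← div_le_iff₀ (N.soloWeight_pos hsolo x s)]
  exact le_csSup (bddAbove_beta₁_set hsolo) ⟨x, hx, s, rfl⟩

lemma sum_soloWeight_nonneg (x : N.Strategy) : 0 ≤ ∑ s, N.soloWeight x s :=
  Finset.sum_nonneg fun s _ => N.soloWeight_nonneg x s

lemma beta₂_nonneg : 0 ≤ N.beta₂ := Real.sSup_nonneg <| by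
  rintro _ ⟨x, -, rfl⟩
  rw [sum_biUnion_soloPaths]
  exact div_nonneg (N.manyWeight_nonneg 0 x) (sum_soloWeight_nonneg x)

lemma sum_soloWeight_pos [Nonempty N.crit] (hsolo : ∀ s : N.crit, (N.soloPaths s).Nonempty)
    (x : N.Strategy) : 0 < ∑ s, N.soloWeight x s :=
  Finset.sum_pos (fun s _ => N.soloWeight_pos hsolo x s) Finset.univ_nonempty

lemma truncWeight_pos [Nonempty N.crit] (hsolo : ∀ s : N.crit, (N.soloPaths s).Nonempty)
    (x : N.Strategy) : 0 < N.truncWeight x :=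
  add_pos_of_nonneg_of_pos N.freeWeight_nonneg (sum_soloWeight_pos hsolo x)

lemma manyWeight_le_beta₂_mul [Nonempty N.crit] (hsolo : ∀ s : N.crit, (N.soloPaths s).Nonempty)
    {x : N.Strategy} (hx : x ∈ N.feasible) :
    N.manyWeight 0 x ≤ N.beta₂ * ∑ s, N.soloWeight x s := by
  rw [← div_le_iff₀ (sum_soloWeight_pos hsolo x)]
  refine le_csSup ?_ ⟨x, hx, by rw [sum_biUnion_soloPaths]; rfl⟩
  have : Continuous fun x => N.manyWeight 0 x / ∑ s, N.soloWeight x s :=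
    (N.continuous_manyWeight 0).div (continuous_finsetSum _ fun s _ => N.continuous_soloWeight s)
      fun x => (sum_soloWeight_pos hsolo x).ne'
  obtain ⟨B, hB⟩ := N.isCompact_feasible.bddAbove_image this.continuousOn
  refine ⟨B, ?_⟩
  rintro _ ⟨y, hy, rfl⟩
  rw [sum_biUnion_soloPaths]
  exact hB ⟨y, hy, rfl⟩

lemma multiPaths_eq_filter (s : N.crit) : N.multiPaths s = {τ ∈ N.manyPaths | s.1 ∈ τ.1} := by
  ext τ
  simp only [manyPaths, Finset.mem_filter, Finset.mem_biUnion, Finset.mem_univ, true_and,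
    mem_multiPaths]
  constructor
  · rintro ⟨h, h'⟩
    exact ⟨⟨s, ⟨h.1, h.2⟩, h'⟩, h.2⟩
  · rintro ⟨⟨t, ⟨h1, h2⟩, t', h3, h4⟩, h5⟩
    refine ⟨⟨h1, h5⟩, ?_⟩
    by_cases h : t = s
    · exact ⟨t', h ▸ h3, h4⟩
    · exact ⟨t, h, h2⟩

lemma sum_mul_multiWeight (c : NodeSeq S → ℝ) (x : N.Strategy) (r : N.crit → ℝ) :
    ∑ s, r s * N.multiWeight c x s =
      ∑ τ ∈ N.manyPaths, N.weight c x τ * ∑ s : N.crit, if s.1 ∈ τ.1 then r s else 0 := by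
  simp_rw [multiWeight, multiPaths_eq_filter, Finset.sum_filter, Finset.mul_sum]
  rw [Finset.sum_comm]
  refine Finset.sum_congr rfl fun τ _ => Finset.sum_congr rfl fun s _ => ?_
  split_ifs <;> ring

/-- In the sum over nodes, every path with several critical nodes is counted at least once. -/
lemma manyWeight_le_sum_multiWeight (c : NodeSeq S → ℝ) (x : N.Strategy) :
    N.manyWeight c x ≤ ∑ s, N.multiWeight c x s := by
  have := sum_mul_multiWeight c x fun _ => 1
  simp only [one_mul] at this
  rw [this]
  refine Finset.sum_le_sum fun τ hτ => le_mul_of_one_le_right (N.weight_pos c x τ).le ?_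
  obtain ⟨s, -, hs⟩ := Finset.mem_biUnion.1 hτ
  have h := Finset.single_le_sum (f := fun s : N.crit => if s.1 ∈ τ.1 then (1 : ℝ) else 0)
    (fun s _ => by split_ifs <;> norm_num) (Finset.mem_univ s)
  simpa only [if_pos (N.mem_multiPaths.1 hs).1.2] using h

/-- The rewards collected along one path sum to at least `-κ`, because `κ` bounds the sum of all
absolute rewards. Hence `κ` is charged once per path, not once per crossing. -/
lemma neg_kappa_mul_manyWeight_le (c : NodeSeq S → ℝ) {x : N.Strategy} (hx : x ∈ N.feasible) :
    -(N.kappa * N.manyWeight c x) ≤ ∑ s, N.reward x s * N.multiWeight c x s := by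
  rw [sum_mul_multiWeight, manyWeight, Finset.mul_sum, ← Finset.sum_neg_distrib]
  refine Finset.sum_le_sum fun τ _ => ?_
  have h1 : |∑ s : N.crit, if s.1 ∈ τ.1 then N.reward x s else 0| ≤ N.kappa := by
    refine (Finset.abs_sum_le_sum_abs _ _).trans (le_trans ?_ (sum_abs_reward_le_kappa hx))
    refine Finset.sum_le_sum fun s _ => ?_
    split_ifs
    · exact le_rfl
    · simp
  have := mul_le_mul_of_nonneg_left (neg_le_of_abs_le h1) (N.weight_pos c x τ).le
  linarith

/-- The objective of the problem in which the adversary uses only paths that cross at most one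
critical node. -/
def truncObjective (N : InterdictionGame S) (x : N.Strategy) : ℝ :=
  N.truncReward x / N.truncWeight x

lemma reward_add_kappa_nonneg {x : N.Strategy} (hx : x ∈ N.feasible) (s : N.crit) :
    0 ≤ N.reward x s + N.kappa := by
  linarith [neg_le_of_abs_le (abs_reward_le_kappa hx s)]

lemma truncReward_add (x : N.Strategy) :
    N.truncReward x + N.kappa * N.truncWeight x =
      N.kappa * N.freeWeight + ∑ s, (N.reward x s + N.kappa) * N.soloWeight x s := by
  simp_rw [add_mul, Finset.sum_add_distrib, ← Finset.mul_sum]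
  rw [truncReward, truncWeight]
  ring

lemma truncReward_add_nonneg {x : N.Strategy} (hx : x ∈ N.feasible) :
    0 ≤ N.truncReward x + N.kappa * N.truncWeight x := by
  rw [truncReward_add]
  exact add_nonneg (mul_nonneg N.kappa_nonneg N.freeWeight_nonneg) (Finset.sum_nonneg fun s _ =>
    mul_nonneg (reward_add_kappa_nonneg hx s) (N.soloWeight_nonneg x s))

variable [Nonempty N.crit]

/-- After the shift by `κ`, the paths with several critical nodes add at most `β₁` times the
truncated numerator. Omitting them from the denominator only increases the quotient. -/
lemma objective_add_kappa_le (hsolo : ∀ s : N.crit, (N.soloPaths s).Nonempty) {x : N.Strategy}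
    (hx : x ∈ N.feasible) :
    N.objective 0 x + N.kappa ≤ (1 + N.beta₁) * (N.truncObjective x + N.kappa) := by
  have hB := truncWeight_pos hsolo x
  have hW := N.manyWeight_nonneg 0 x
  have hBW : 0 < N.truncWeight x + N.manyWeight 0 x := by linarith
  have hT := truncReward_add_nonneg hx
  have h1 : ∑ s, N.reward x s * N.multiWeight 0 x s + N.kappa * N.manyWeight 0 x ≤
      ∑ s, (N.reward x s + N.kappa) * N.multiWeight 0 x s := by
    simp_rw [add_mul, Finset.sum_add_distrib, ← Finset.mul_sum]
    have := mul_le_mul_of_nonneg_left (manyWeight_le_sum_multiWeight 0 x) N.kappa_nonneg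
    linarith
  have h2 : ∑ s, (N.reward x s + N.kappa) * N.multiWeight 0 x s ≤
      N.beta₁ * ∑ s, (N.reward x s + N.kappa) * N.soloWeight x s := by
    rw [Finset.mul_sum]
    refine Finset.sum_le_sum fun s _ => ?_
    have := mul_le_mul_of_nonneg_left (multiWeight_le_beta₁_mul hsolo hx s)
      (reward_add_kappa_nonneg hx s)
    linarith
  have h3 : ∑ s, (N.reward x s + N.kappa) * N.soloWeight x s ≤
      N.truncReward x + N.kappa * N.truncWeight x := by
    rw [truncReward_add]
    linarith [mul_nonneg N.kappa_nonneg N.freeWeight_nonneg]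
  have h4 := mul_le_mul_of_nonneg_left h3 (beta₁_nonneg (N := N))
  have h5 : N.objective 0 x + N.kappa = (N.truncReward x + N.kappa * N.truncWeight x +
      (∑ s, N.reward x s * N.multiWeight 0 x s + N.kappa * N.manyWeight 0 x)) /
        (N.truncWeight x + N.manyWeight 0 x) := by
    rw [IsCostIncrease.objective_eq (IsCostIncrease.zero N), div_add' _ _ _ hBW.ne']
    ring
  have h6 : (1 + N.beta₁) * (N.truncObjective x + N.kappa) =
      (1 + N.beta₁) * (N.truncReward x + N.kappa * N.truncWeight x) / N.truncWeight x := by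
    rw [truncObjective, div_add' _ _ _ hB.ne', mul_div_assoc]
  rw [h5, h6]
  refine div_le_div₀ (mul_nonneg ?_ hT) (by linarith) hB (by linarith)
  linarith [beta₁_nonneg (N := N)]

/-- The shifted numerator does not grow when the paths with several critical nodes are omitted, and
their presence enlarges the denominator by at most the factor `1 + β₂`. -/
lemma truncObjective_add_kappa_le (hsolo : ∀ s : N.crit, (N.soloPaths s).Nonempty)
    {x : N.Strategy} (hx : x ∈ N.feasible) :
    N.truncObjective x + N.kappa ≤ (1 + N.beta₂) * (N.objective 0 x + N.kappa) := by
  have hB := truncWeight_pos hsolo x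
  have hW := N.manyWeight_nonneg 0 x
  have hBW : 0 < N.truncWeight x + N.manyWeight 0 x := by linarith
  have hT := truncReward_add_nonneg hx
  have hb := beta₂_nonneg (N := N)
  have h1 : N.truncReward x + N.kappa * N.truncWeight x ≤
      (N.objective 0 x + N.kappa) * (N.truncWeight x + N.manyWeight 0 x) := by
    rw [IsCostIncrease.objective_eq (IsCostIncrease.zero N), add_mul, div_mul_cancel₀ _ hBW.ne']
    linarith [neg_kappa_mul_manyWeight_le 0 hx]
  have h2 : 0 ≤ N.objective 0 x + N.kappa := nonneg_of_mul_nonneg_left (hT.trans h1) hBW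
  have h3 : N.truncWeight x + N.manyWeight 0 x ≤ (1 + N.beta₂) * N.truncWeight x := by
    have := manyWeight_le_beta₂_mul hsolo hx
    have := mul_nonneg hb N.freeWeight_nonneg
    rw [truncWeight]
    linarith
  have h4 := mul_le_mul_of_nonneg_left h3 h2
  rw [truncObjective, div_add' _ _ _ hB.ne', div_le_iff₀ hB]
  linarith

lemma IsCostIncrease.searchObjective_eq_mul (hc : N.IsCostIncrease c)
    (hsolo : ∀ s : N.crit, (N.soloPaths s).Nonempty) (x : N.Strategy) (δ : ℝ) :
    N.searchObjective c x δ =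
      (N.objective c x - δ) * (N.truncWeight x + N.manyWeight c x) := by
  have hB := truncWeight_pos hsolo x
  have hW := N.manyWeight_nonneg c x
  have hBW : N.truncWeight x + N.manyWeight c x ≠ 0 := by linarith
  rw [hc.objective_eq, hc.searchObjective_eq, sub_mul, div_mul_cancel₀ _ hBW, truncSearch,
    manySearch]
  ring

lemma IsCostIncrease.searchObjective_nonneg_iff (hc : N.IsCostIncrease c)
    (hsolo : ∀ s : N.crit, (N.soloPaths s).Nonempty) (x : N.Strategy) (δ : ℝ) :
    0 ≤ N.searchObjective c x δ ↔ δ ≤ N.objective c x := by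
  have hB := truncWeight_pos hsolo x
  have hW := N.manyWeight_nonneg c x
  rw [hc.searchObjective_eq_mul hsolo, mul_nonneg_iff_of_pos_right (by linarith), sub_nonneg]

lemma IsCostIncrease.searchObjective_nonpos_iff (hc : N.IsCostIncrease c)
    (hsolo : ∀ s : N.crit, (N.soloPaths s).Nonempty) (x : N.Strategy) (δ : ℝ) :
    N.searchObjective c x δ ≤ 0 ↔ N.objective c x ≤ δ := by
  have hB := truncWeight_pos hsolo x
  have hW := N.manyWeight_nonneg c x
  have hBW : 0 < N.truncWeight x + N.manyWeight c x := by linarith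
  rw [hc.searchObjective_eq_mul hsolo]
  constructor
  · intro h
    by_contra h'
    exact absurd h (not_le.2 (mul_pos (by linarith) hBW))
  · intro h
    exact mul_nonpos_of_nonpos_of_nonneg (by linarith) hBW.le

end

/-! ### Limit behaviour of the binary search. -/

section

variable {S : Type*} [Fintype S] {N : InterdictionGame S} {c : NodeSeq S → ℝ}

lemma abs_objective_le_kappa (c : NodeSeq S → ℝ) {x : N.Strategy} (hx : x ∈ N.feasible) :
    |N.objective c x| ≤ N.kappa := by
  refine (Finset.abs_sum_le_sum_abs _ _).trans (le_trans ?_ (sum_abs_reward_le_kappa hx))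
  refine Finset.sum_le_sum fun s _ => ?_
  have h0 : 0 ≤ N.crossProb c x s := Finset.sum_nonneg fun τ _ =>
    div_nonneg (N.weight_pos _ _ _).le (Finset.sum_nonneg fun _ _ => (N.weight_pos _ _ _).le)
  have h1 : N.crossProb c x s ≤ 1 := by
    simp_rw [crossProb, pathProb]
    rw [← Finset.sum_div]
    exact div_le_one_of_le₀ (Finset.sum_le_sum_of_subset_of_nonneg (Finset.filter_subset _ _)
      fun _ _ _ => (N.weight_pos _ _ _).le) (Finset.sum_nonneg fun _ _ => (N.weight_pos _ _ _).le)
  rw [abs_mul, abs_of_nonneg h0]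
  exact mul_le_of_le_one_right (abs_nonneg _) h1

lemma bisection_snd_sub_fst (c : NodeSeq S → ℝ) (sol : ℝ → N.Strategy) (a b : ℝ) (n : ℕ) :
    (N.bisection c sol a b n).2 - (N.bisection c sol a b n).1 = (b - a) * (1 / 2) ^ n := by
  induction n with
  | zero => simp [bisection]
  | succ n ih =>
    rw [bisection, pow_succ, ← mul_assoc, ← ih]
    split_ifs <;> ring

/-- Each endpoint is either an initial one or a midpoint whose test determined its side, so the
signs persist. -/
lemma searchObjective_bisection (c : NodeSeq S → ℝ) (sol : ℝ → N.Strategy) {a b : ℝ}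
    (ha : 0 ≤ N.searchObjective c (sol a) a) (hb : N.searchObjective c (sol b) b ≤ 0) (n : ℕ) :
    0 ≤ N.searchObjective c (sol (N.bisection c sol a b n).1) (N.bisection c sol a b n).1 ∧
      N.searchObjective c (sol (N.bisection c sol a b n).2) (N.bisection c sol a b n).2 ≤ 0 := by
  induction n with
  | zero => exact ⟨ha, hb⟩
  | succ n ih =>
    rw [bisection]
    split_ifs with h
    · exact ⟨h, ih.2⟩
    · exact ⟨ih.1, (not_le.1 h).le⟩

/-- The coefficient of `ε` in the bound on the contribution of the paths that cross at least two
critical nodes. -/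
def manyCoeff (N : InterdictionGame S) (K : ℝ) : ℝ :=
  N.kappa * (⨆ s, N.rhoThrough s) + K * N.rho

lemma IsLocalSolution.truncSearch_le {ε : ℝ} (hε : 0 ≤ ε) (hc : N.IsCostIncrease c)
    (hsep : N.IsSeparated c ε) {x z : N.Strategy} {δ : ℝ} (hx : N.IsLocalSolution c δ x)
    (hg : N.searchObjective c x δ ≤ 0) (hz : z ∈ N.feasible) :
    N.truncSearch z δ ≤ ε * (N.gapCoeff |δ| + N.manyCoeff |δ|) := by
  have h1 := hx.truncSearch_sub_le hε hc hsep hz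
  have h2 := neg_le_of_abs_le (hsep.abs_manySearch_le hε hc hx.1 δ)
  rw [hc.searchObjective_eq] at hg
  rw [manyCoeff]
  linarith

open Filter Topology in
/-- What the analysis uses of the binary search. -/
lemma IsBinarySearchOutput.spec [Nonempty N.crit]
    (hsolo : ∀ s : N.crit, (N.soloPaths s).Nonempty) (hc : N.IsCostIncrease c) {x : N.Strategy}
    {δ : ℝ} (hx : N.IsBinarySearchOutput c x δ) :
    x ∈ N.feasible ∧ 0 ≤ N.searchObjective c x δ ∧ |δ| ≤ N.kappa ∧
      ∀ ε, 0 ≤ ε → N.IsSeparated c ε → ∀ z ∈ N.feasible,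
        N.truncSearch z δ ≤ ε * (N.gapCoeff |δ| + N.manyCoeff |δ|) := by
  rcases hx with ⟨hx, h0⟩ | ⟨sol, a, b, hsol, hab, hlim, hcl⟩
  · have h1 := (hc.searchObjective_nonneg_iff hsolo x δ).1 h0.ge
    have h2 := (hc.searchObjective_nonpos_iff hsolo x δ).1 h0.le
    refine ⟨hx.1, h0.ge, ?_, fun ε hε hsep z hz => hx.truncSearch_le hε hc hsep h0.le hz⟩
    rw [le_antisymm h1 h2]
    exact abs_objective_le_kappa c hx.1
  set lo := fun n => (N.bisection c sol a b n).1
  set hi := fun n => (N.bisection c sol a b n).2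
  have hinv : ∀ n, 0 ≤ N.searchObjective c (sol (lo n)) (lo n) ∧
      N.searchObjective c (sol (hi n)) (hi n) ≤ 0 := searchObjective_bisection c sol
    ((hc.searchObjective_nonneg_iff hsolo _ _).2 (hab _ (hsol a).1).1)
    ((hc.searchObjective_nonpos_iff hsolo _ _).2 (hab _ (hsol b).1).2)
  have hhi : Tendsto hi atTop (𝓝 δ) := by
    have h1 : Tendsto (fun n : ℕ => (b - a) * (1 / 2 : ℝ) ^ n) atTop (𝓝 0) := by
      simpa using (tendsto_pow_atTop_nhds_zero_of_lt_one (by norm_num)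
        (by norm_num : (1 / 2 : ℝ) < 1)).const_mul (b - a)
    have h2 := hlim.add h1
    rw [add_zero] at h2
    refine h2.congr fun n => ?_
    rw [← bisection_snd_sub_fst c sol a b n]
    exact add_sub_cancel _ _
  have hxf : x ∈ N.feasible := N.isCompact_feasible.isClosed.mem_of_mapClusterPt hcl
    (Eventually.of_forall fun n => (hsol (lo n)).1)
  have hg : 0 ≤ N.searchObjective c x δ := by
    -- Along a suitable ultrafilter the solutions at the lower ends converge to `x`, and joint
    -- continuity in `(x, δ)` preserves the sign.
    obtain ⟨U, hU, hUx⟩ := mapClusterPt_iff_ultrafilter.1 hcl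
    have h := ((N.continuous_searchObjective c).tendsto (x, δ)).comp
      (hUx.prodMk_nhds (hlim.mono_left hU))
    exact ge_of_tendsto' h fun n => (hinv n).1
  refine ⟨hxf, hg, abs_le.2 ⟨?_, ?_⟩, fun ε hε hsep z hz => ?_⟩
  · refine ge_of_tendsto' hhi fun n => ?_
    exact (neg_le_of_abs_le (abs_objective_le_kappa c (hsol (hi n)).1)).trans
      ((hc.searchObjective_nonpos_iff hsolo _ _).1 (hinv n).2)
  · exact ((hc.searchObjective_nonneg_iff hsolo _ _).1 hg).trans
      (le_of_abs_le (abs_objective_le_kappa c hxf))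
  · have h1 : Continuous fun d => N.truncSearch z d := by
      unfold truncSearch
      fun_prop
    have h2 : Continuous fun d => ε * (N.gapCoeff |d| + N.manyCoeff |d|) := by
      unfold gapCoeff manyCoeff
      fun_prop
    -- The estimate at the upper ends involves only the fixed `z` and the parameter. Convergence of
    -- their solutions is not needed, nor is local maximality of the limit point `x`.
    exact le_of_tendsto_of_tendsto' ((h1.tendsto δ).comp hhi) ((h2.tendsto δ).comp hhi)
      fun n => (hsol (hi n)).truncSearch_le hε hc hsep (hinv n).2 hz

/-! ### Additive near-optimality for the truncated ratio. -/

lemma gapCoeff_mono : Monotone N.gapCoeff := fun K K' h => by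
  refine Finset.sum_le_sum fun s _ => mul_le_mul_of_nonneg_right ?_ (Real.exp_pos _).le
  linarith [mul_le_mul_of_nonneg_right h N.rho_nonneg]

lemma constH_nonneg : 0 ≤ N.constH := by
  refine mul_nonneg two_pos.le (Finset.sum_nonneg fun s _ => mul_nonneg ?_ (Real.exp_pos _).le)
  have h1 := mul_nonneg N.kappa_nonneg N.rho_nonneg
  have h2 := mul_nonneg N.kappa_nonneg N.iSup_rhoThrough_nonneg
  have h3 := mul_nonneg (mul_nonneg N.mu_pos.le (div_nonneg (N.wl_pos s).le (abs_nonneg (N.wf s))))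
    (N.rhoThrough_nonneg s)
  linarith

lemma constC_nonneg : 0 ≤ N.constC :=
  add_nonneg (mul_nonneg N.kappa_nonneg N.iSup_rhoThrough_nonneg)
    (mul_nonneg N.kappa_nonneg N.rho_nonneg)

lemma lam_nonneg : 0 ≤ N.lam := sum_soloWeight_nonneg _

lemma lam_le {x : N.Strategy} (hx : x ∈ N.feasible) : N.lam ≤ ∑ s, N.soloWeight x s :=
  Finset.sum_le_sum fun _ _ => Finset.sum_le_sum fun _ _ => N.weight_anti 0 (fun s => (hx.2 s).2) _

variable [Nonempty N.crit]

lemma lam_pos (hsolo : ∀ s : N.crit, (N.soloPaths s).Nonempty) : 0 < N.lam :=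
  sum_soloWeight_pos hsolo _

/-- The output of the binary search is almost optimal for the restricted objective. -/
lemma IsBinarySearchOutput.truncObjective_sub_le
    (hsolo : ∀ s : N.crit, (N.soloPaths s).Nonempty) (hc : N.IsCostIncrease c) {x z : N.Strategy}
    {δ ε : ℝ} (hx : N.IsBinarySearchOutput c x δ) (hε : 0 ≤ ε) (hsep : N.IsSeparated c ε)
    (hz : z ∈ N.feasible) :
    N.truncObjective z - N.truncObjective x ≤
      ε * (N.constH + 2 * N.constC) / (N.freeWeight + N.lam) := by
  obtain ⟨hxf, hg, hδ, hopt⟩ := hx.spec hsolo hc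
  have hD : 0 < N.freeWeight + N.lam := add_pos_of_nonneg_of_pos N.freeWeight_nonneg (lam_pos hsolo)
  have hC : N.manyCoeff |δ| ≤ N.constC := by
    rw [manyCoeff, constC]
    linarith [mul_le_mul_of_nonneg_right hδ N.rho_nonneg]
  -- By definition `constH` is `2 * gapCoeff κ`.
  have hH : 2 * N.gapCoeff |δ| ≤ N.constH :=
    mul_le_mul_of_nonneg_left (gapCoeff_mono hδ) two_pos.le
  have hH0 := constH_nonneg (N := N)
  have hC0 := constC_nonneg (N := N)
  have hle : ∀ y ∈ N.feasible, N.freeWeight + N.lam ≤ N.truncWeight y := fun y hy => by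
    rw [truncWeight]
    linarith [lam_le hy]
  -- The parameter `δ` is compared with both ratios: near-optimality bounds the ratio at `z` from
  -- above, and the nonnegative subproblem value bounds that at `x` from below.
  have h1 : N.truncObjective z - δ ≤ ε * (N.constH / 2 + N.constC) / (N.freeWeight + N.lam) := by
    have hB := truncWeight_pos hsolo z
    have h : N.truncObjective z - δ = N.truncSearch z δ / N.truncWeight z := by
      rw [truncObjective, truncSearch, sub_div, mul_div_cancel_right₀ _ hB.ne']
    have h' : N.truncSearch z δ ≤ ε * (N.constH / 2 + N.constC) :=
      (hopt ε hε hsep z hz).trans (mul_le_mul_of_nonneg_left (by linarith) hε)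
    rw [h]
    exact div_le_div₀ (mul_nonneg hε (by linarith)) h' hD (hle z hz)
  have h2 : δ - N.truncObjective x ≤ ε * N.constC / (N.freeWeight + N.lam) := by
    have hB := truncWeight_pos hsolo x
    have h : δ - N.truncObjective x = -N.truncSearch x δ / N.truncWeight x := by
      rw [truncObjective, truncSearch, neg_sub, sub_div, mul_div_cancel_right₀ _ hB.ne']
    have h' : -N.truncSearch x δ ≤ ε * N.constC := by
      rw [hc.searchObjective_eq] at hg
      have h3 := le_of_abs_le (hsep.abs_manySearch_le hε hc hxf δ)
      have h4 := mul_le_mul_of_nonneg_left hC hε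
      rw [manyCoeff] at h4
      linarith
    rw [h]
    exact div_le_div₀ (mul_nonneg hε hC0) h' hD (hle x hxf)
  have h3 : ε * (N.constH / 2 + N.constC) / (N.freeWeight + N.lam) +
      ε * N.constC / (N.freeWeight + N.lam) ≤
      ε * (N.constH + 2 * N.constC) / (N.freeWeight + N.lam) := by
    rw [← add_div]
    refine div_le_div_of_nonneg_right ?_ hD.le
    linarith [mul_nonneg hε hH0]
  linarith

/-! ### From additive to multiplicative error. -/

lemma restrictedObjective_eq (x : N.Strategy) :
    N.restrictedObjective x = N.truncReward x / ∑ s, N.soloWeight x s := by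
  simp_rw [restrictedObjective, ← Finset.mul_sum]
  rfl

lemma restrictedObjective_add_mul (hsolo : ∀ s : N.crit, (N.soloPaths s).Nonempty)
    (x : N.Strategy) : (N.restrictedObjective x + N.kappa) * ∑ s, N.soloWeight x s =
      ∑ s, (N.reward x s + N.kappa) * N.soloWeight x s := by
  rw [restrictedObjective_eq, add_mul, div_mul_cancel₀ _ (sum_soloWeight_pos hsolo x).ne']
  simp_rw [add_mul, Finset.sum_add_distrib, ← Finset.mul_sum]
  rfl

lemma neg_kappa_le_restrictedObjective (hsolo : ∀ s : N.crit, (N.soloPaths s).Nonempty)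
    {x : N.Strategy} (hx : x ∈ N.feasible) : -N.kappa ≤ N.restrictedObjective x := by
  have h : 0 ≤ (N.restrictedObjective x + N.kappa) * ∑ s, N.soloWeight x s := by
    rw [restrictedObjective_add_mul hsolo]
    exact Finset.sum_nonneg fun s _ =>
      mul_nonneg (reward_add_kappa_nonneg hx s) (N.soloWeight_nonneg x s)
  linarith [nonneg_of_mul_nonneg_left h (sum_soloWeight_pos hsolo x)]

lemma sInf_restrictedObjective_le (hsolo : ∀ s : N.crit, (N.soloPaths s).Nonempty)
    {x : N.Strategy} (hx : x ∈ N.feasible) :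
    sInf (N.restrictedObjective '' N.feasible) ≤ N.restrictedObjective x := by
  refine csInf_le ⟨-N.kappa, ?_⟩ ⟨x, hx, rfl⟩
  rintro _ ⟨y, hy, rfl⟩
  exact neg_kappa_le_restrictedObjective hsolo hy

lemma neg_kappa_le_sInf (hsolo : ∀ s : N.crit, (N.soloPaths s).Nonempty)
    (hne : N.feasible.Nonempty) : -N.kappa ≤ sInf (N.restrictedObjective '' N.feasible) := by
  refine le_csInf (hne.image _) ?_
  rintro _ ⟨y, hy, rfl⟩
  exact neg_kappa_le_restrictedObjective hsolo hy

/-- Paths without critical nodes contribute `κ * freeWeight ≥ 0` to the shifted numerator. The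
weights are compared through `lam / (freeWeight + lam) ≤ Z / (freeWeight + Z)`, which follows from
`lam ≤ Z`. This is what lets the denominator of `constU` absorb the additive error. -/
lemma sInf_add_kappa_mul_lam_le (hsolo : ∀ s : N.crit, (N.soloPaths s).Nonempty)
    {x : N.Strategy} (hx : x ∈ N.feasible) :
    (sInf (N.restrictedObjective '' N.feasible) + N.kappa) * N.lam ≤
      (N.truncObjective x + N.kappa) * (N.freeWeight + N.lam) := by
  set m := sInf (N.restrictedObjective '' N.feasible)
  set Z := ∑ s, N.soloWeight x s with hZ
  have hm : 0 ≤ m + N.kappa := by linarith [neg_kappa_le_sInf hsolo ⟨x, hx⟩]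
  have hB := truncWeight_pos hsolo x
  have hf := N.freeWeight_nonneg
  have hlam := lam_nonneg (N := N)
  have hZ0 : 0 ≤ Z := sum_soloWeight_nonneg x
  have h1 : (m + N.kappa) * Z ≤ N.truncReward x + N.kappa * N.truncWeight x := by
    rw [truncReward_add, ← restrictedObjective_add_mul hsolo]
    have := mul_le_mul_of_nonneg_right (sInf_restrictedObjective_le hsolo hx) hZ0
    linarith [mul_nonneg N.kappa_nonneg hf]
  have h2 : N.lam * N.truncWeight x ≤ Z * (N.freeWeight + N.lam) := by
    rw [truncWeight, ← hZ]
    linarith [mul_le_mul_of_nonneg_right (lam_le hx) hf]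
  rw [truncObjective, div_add' _ _ _ hB.ne', div_mul_eq_mul_div, le_div_iff₀ hB]
  have h3 := mul_le_mul_of_nonneg_left h2 hm
  have h4 := mul_le_mul_of_nonneg_right h1 (add_nonneg hf hlam)
  linarith

omit [Nonempty N.crit] in
lemma isSeparated_zero_of_subsingleton [Subsingleton N.crit] (c : NodeSeq S → ℝ) :
    N.IsSeparated c 0 := by
  have h : ∀ s, N.multiPaths s = ∅ := fun s => Finset.eq_empty_of_forall_notMem fun τ hτ => by
    obtain ⟨-, s', hs, -⟩ := N.mem_multiPaths.1 hτ
    exact hs (Subsingleton.elim _ _)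
  constructor
  · intro x _ s
    rw [h]
    simp
  · intro x _
    rw [show Finset.univ.biUnion N.multiPaths = ∅ by ext; simp [h]]
    simp

/-- If the restricted objective attains the lower bound `-κ`, then either there are no rewards or
there is only one critical node. -/
lemma kappa_eq_zero_or_subsingleton (hsolo : ∀ s : N.crit, (N.soloPaths s).Nonempty)
    (hne : N.feasible.Nonempty)
    (h : sInf (N.restrictedObjective '' N.feasible) + N.kappa = 0) :
    N.kappa = 0 ∨ Subsingleton N.crit := by
  have hcont : Continuous N.restrictedObjective := by
    rw [funext fun x => restrictedObjective_eq (N := N) x]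
    exact (continuous_finsetSum _ fun s _ => (N.continuous_reward s).mul
      (N.continuous_soloWeight s)).div (continuous_finsetSum _ fun s _ =>
        N.continuous_soloWeight s) fun x => (sum_soloWeight_pos hsolo x).ne'
  obtain ⟨y, hy, hy'⟩ := N.isCompact_feasible.exists_sInf_image_eq hne hcont.continuousOn
  have h0 := restrictedObjective_add_mul hsolo y
  rw [← hy', h, zero_mul, eq_comm, Finset.sum_eq_zero_iff_of_nonneg fun s _ =>
    mul_nonneg (reward_add_kappa_nonneg hy s) (N.soloWeight_nonneg y s)] at h0
  -- A vanishing sum of nonnegative terms with positive weights forces every reward to equal `-κ`;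
  -- summing absolute values then gives `card * κ ≤ κ`.
  have hr : ∀ s, |N.reward y s| = N.kappa := fun s => by
    have := (mul_eq_zero.1 (h0 s (Finset.mem_univ s))).resolve_right
      (N.soloWeight_pos hsolo y s).ne'
    rw [eq_neg_of_add_eq_zero_left this, abs_neg, abs_of_nonneg N.kappa_nonneg]
  have hk := sum_abs_reward_le_kappa hy
  rw [Finset.sum_congr rfl fun s _ => hr s, Finset.sum_const, nsmul_eq_mul, Finset.card_univ] at hk
  rcases N.kappa_nonneg.eq_or_lt with h1 | h1
  · exact Or.inl h1.symm
  · right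
    rw [← Fintype.card_le_one_iff_subsingleton]
    have : (Fintype.card N.crit : ℝ) ≤ 1 := by
      by_contra h2
      nlinarith
    exact_mod_cast this

omit [Nonempty N.crit] in
lemma truncObjective_eq_zero (hk : N.kappa = 0) {x : N.Strategy} (hx : x ∈ N.feasible) :
    N.truncObjective x = 0 := by
  rw [truncObjective, truncReward, Finset.sum_eq_zero, zero_div]
  intro s _
  rw [abs_nonpos_iff.1 ((abs_reward_le_kappa hx s).trans_eq hk), zero_mul]

lemma constU_nonneg (hsolo : ∀ s : N.crit, (N.soloPaths s).Nonempty)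
    (hne : N.feasible.Nonempty) : 0 ≤ N.constU := by
  refine div_nonneg ?_ (mul_nonneg ?_ lam_nonneg)
  · linarith [constH_nonneg (N := N), constC_nonneg (N := N)]
  · linarith [neg_kappa_le_sInf hsolo hne]

lemma IsBinarySearchOutput.truncObjective_add_kappa_le
    (hsolo : ∀ s : N.crit, (N.soloPaths s).Nonempty) (hc : N.IsCostIncrease c) {x z : N.Strategy}
    {δ ε : ℝ} (hx : N.IsBinarySearchOutput c x δ) (hε : 0 ≤ ε) (hsep : N.IsSeparated c ε)
    (hz : z ∈ N.feasible) :
    N.truncObjective z + N.kappa ≤ (1 + ε * N.constU) * (N.truncObjective x + N.kappa) := by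
  have hxf := (hx.spec hsolo hc).1
  have hD : 0 < N.freeWeight + N.lam := add_pos_of_nonneg_of_pos N.freeWeight_nonneg (lam_pos hsolo)
  have hm : 0 ≤ sInf (N.restrictedObjective '' N.feasible) + N.kappa := by
    linarith [neg_kappa_le_sInf hsolo ⟨x, hxf⟩]
  rcases hm.eq_or_lt with h0 | h0
  -- Division by zero makes `constU` equal to `0`, so exact optimality is required.
  · rw [constU, ← h0, zero_mul, div_zero, mul_zero, add_zero, one_mul]
    rcases kappa_eq_zero_or_subsingleton hsolo ⟨x, hxf⟩ h0.symm with hk | hs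
    · rw [truncObjective_eq_zero hk hz, truncObjective_eq_zero hk hxf]
    -- With a single critical node no path crosses two, so the additive estimate applies with `ε =
    -- 0`.
    · have := hx.truncObjective_sub_le hsolo hc le_rfl (isSeparated_zero_of_subsingleton c) hz
      rw [zero_mul, zero_div] at this
      linarith
  · have h1 := hx.truncObjective_sub_le hsolo hc hε hsep hz
    have h2 := sInf_add_kappa_mul_lam_le hsolo hxf
    have h3 := mul_le_mul_of_nonneg_left h2 (mul_nonneg hε (constU_nonneg hsolo ⟨x, hxf⟩))
    have h4 : N.constU * ((sInf (N.restrictedObjective '' N.feasible) + N.kappa) * N.lam) =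
        N.constH + 2 * N.constC := div_mul_cancel₀ _ (mul_pos h0 (lam_pos hsolo)).ne'
    have h5 : ε * (N.constH + 2 * N.constC) / (N.freeWeight + N.lam) ≤
        ε * N.constU * (N.truncObjective x + N.kappa) := by
      rw [div_le_iff₀ hD, ← h4]
      linarith
    linarith

lemma IsBinarySearchOutput.objective_add_kappa_le
    (hsolo : ∀ s : N.crit, (N.soloPaths s).Nonempty) (hc : N.IsCostIncrease c) {x z : N.Strategy}
    {δ ε : ℝ} (hx : N.IsBinarySearchOutput c x δ) (hε : 0 ≤ ε) (hsep : N.IsSeparated c ε)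
    (hz : z ∈ N.feasible) :
    N.objective 0 z + N.kappa ≤ N.etaBar ε * (N.objective 0 x + N.kappa) := by
  have hxf := (hx.spec hsolo hc).1
  have hb := beta₁_nonneg (N := N)
  have hu := mul_nonneg hε (constU_nonneg hsolo ⟨x, hxf⟩)
  calc N.objective 0 z + N.kappa
      ≤ (1 + N.beta₁) * (N.truncObjective z + N.kappa) :=
        InterdictionGame.objective_add_kappa_le hsolo hz
    _ ≤ (1 + N.beta₁) * ((1 + ε * N.constU) * (N.truncObjective x + N.kappa)) :=
        mul_le_mul_of_nonneg_left (hx.truncObjective_add_kappa_le hsolo hc hε hsep hz)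
          (by linarith)
    _ ≤ (1 + N.beta₁) * ((1 + ε * N.constU) * ((1 + N.beta₂) * (N.objective 0 x + N.kappa))) :=
        mul_le_mul_of_nonneg_left (mul_le_mul_of_nonneg_left
          (InterdictionGame.truncObjective_add_kappa_le hsolo hxf) (by linarith)) (by linarith)
    _ = N.etaBar ε * (N.objective 0 x + N.kappa) := by
        rw [etaBar]
        ring

lemma etaBar_pos (hsolo : ∀ s : N.crit, (N.soloPaths s).Nonempty) (hne : N.feasible.Nonempty)
    {ε : ℝ} (hε : 0 ≤ ε) : 0 < N.etaBar ε := by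
  have h1 := beta₁_nonneg (N := N)
  have h2 := beta₂_nonneg (N := N)
  have h3 := mul_nonneg hε (constU_nonneg hsolo hne)
  rw [etaBar]
  positivity

end

end InterdictionGame

end

/-! ### Conclusion. -/

theorem theorem6 {S : Type*} [Fintype S] (N : InterdictionGame S)
    (hsolo : ∀ s : N.crit, (N.soloPaths s).Nonempty)
    (c : InterdictionGame.NodeSeq S → ℝ) (hc : N.IsCostIncrease c)
    (ε : ℝ) (hε : 0 < ε) (hsep : N.IsSeparated c ε)
    (x : N.Strategy) (δ : ℝ) (hx : N.IsBinarySearchOutput c x δ) :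
    N.objective 0 x ≥
      1 / N.etaBar ε * sSup (N.objective 0 '' N.feasible)
        - N.kappa * ((N.etaBar ε - 1) / N.etaBar ε) := by
  rcases isEmpty_or_nonempty N.crit with hE | hE
  -- Without critical nodes the objective and `κ` vanish, whatever the value of `etaBar`.
  · have h0 : ∀ y, N.objective 0 y = 0 := fun y => by simp [InterdictionGame.objective]
    have h1 : sSup (N.objective 0 '' N.feasible) = 0 := by
      refine le_antisymm (Real.sSup_nonpos ?_) (Real.sSup_nonneg ?_) <;>
      · rintro _ ⟨y, -, rfl⟩
        simp [h0]
    have h2 : N.kappa = 0 := by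
      refine le_antisymm (Real.sSup_nonpos ?_) N.kappa_nonneg
      rintro _ ⟨y, -, rfl⟩
      simp
    rw [h0, h1, h2]
    simp
  · have hxf := (hx.spec hsolo hc).1
    have hη := InterdictionGame.etaBar_pos hsolo ⟨x, hxf⟩ hε.le
    have h : sSup (N.objective 0 '' N.feasible) ≤
        N.etaBar ε * (N.objective 0 x + N.kappa) - N.kappa := by
      refine csSup_le (Set.Nonempty.image _ ⟨x, hxf⟩) ?_
      rintro _ ⟨y, hy, rfl⟩
      linarith [hx.objective_add_kappa_le hsolo hc hε.le hsep hy]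
    rw [ge_iff_le, one_div_mul_eq_div, mul_div_assoc', ← sub_div, div_le_iff₀ hη]
    linarith
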